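/- Let $k$ be an even integer with $k\ge 2$. For an even integer $w$ and $z=x+iy$ in the upper half-plane $\mathbb H$, put $$E_w(z,s)=\frac12\sum_{(m,n)\in\mathbb Z^2\setminus\{(0,0)\}}\frac{y^s}{(mz+n)^{w}\,|mz+n|^{2s}}\qquad(\Re s>1-\tfrac w2),$$ and let $$\widehat{\widehat E}_w(z,s)=\Big(s+\frac w2\Big)\Big(s+\frac w2-1\Big)\,\pi^{-(s+w/2)}\,\Gamma\Big(s+\frac w2+\frac{|w|}2\Big)E_w(z,s),$$ continued analytically in $s$. Let $\xi_w f=2i\,y^{w}\,\overline{\partial f/\partial\bar z}$ with $\frac{\partial}{\partial\bar z}=\frac12\big(\frac{\partial}{\partial x}+i\frac{\partial}{\partial y}\big)$, and let $\Delta_w=y^2\big(\frac{\partial^2}{\partial x^2}+\frac{\partial^2}{\partial y^2}\big)-iwy\big(\frac{\partial}{\partial x}+i\frac{\partial}{\partial y}\big)$. For $w=k$ and $w=2-k$ and every $z\in\mathbb H$, the function $\widehat{\widehat E}_w(z,s)$ extends to an entire function of $s$. Write its Taylor expansions at $s=0$ as $$\widehat{\widehat E}_k(z,s)=\sum_{n\ge0}G_{n,k}(z)s^n,\qquad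 \widehat{\widehat E}_{2-k}(z,s)=\sum_{n\ge0}F_{n,2-k}(z)s^n .$$ Let $c_{n,k,\ell}$ ($n\ge0$, $1\le\ell\le n+1$) be complex constants and set $c_{n,k,0}=1$, $c_{n,k,-1}=0$. Define for $n\ge 0$ $$\widetilde G_{n,k}=G_{n,k}+\sum_{\ell=1}^n(-1)^\ell c_{n,k,\ell}\,G_{n-\ell,k},\qquad \widetilde F_{n,2-k}=(-1)^n\Big(F_{n,2-k}+\sum_{\ell=1}^n\overline{c_{n,k,\ell}}\,F_{n-\ell,2-k}\Big).$$ Suppose that the connection equations $$c_{n,k,\ell}=\frac1{k-1}\,c_{n,k,\ell-1}+c_{n-1,k,\ell}\qquad(n\ge1,\ 0\le\ell\le n)$$ hold. Then all $\widetilde G_{n,k}$ and $\widetilde F_{n,2-k}$ are $C^\infty$ functions of $(x,y)$ on $\mathbb H$, and for every $n\ge1$: 1. (ramp relations) $\xi_k\widetilde G_{n,k}=(k-1)\,\widetilde F_{n-1,2-k}$ and $\xi_{2-k}\widetilde F_{n,2-k}=\widetilde G_{n,k}$; 2. (tower relations) $\Delta_k\widetilde G_{n,k}=(k-1)\,\widetilde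 G_{n-1,k}$ and $\Delta_{2-k}\widetilde F_{n,2-k}=(k-1)\,\widetilde F_{n-1,2-k}$. Moreover the constants $c_{n,k,n+1}$ ($n\ge0$) are free: for every complex sequence $(d_n)_{n\ge0}$ the connection equations have a solution with $c_{n,k,n+1}=d_n$ for all $n\ge0$. -/

import Mathlib

open scoped UpperHalfPlane ContDiff ComplexConjugate

noncomputable section

namespace PolyMaass

/-- The non-holomorphic Eisenstein series
`E_k(z,s) = (1/2) ∑_{(m,n) ≠ (0,0)} y^s / ((m z + n)^k |m z + n|^{2 s})`,
absolutely convergent for `Re s > 1 - k / 2`. -/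
def eisSeries (k : ℤ) (z : ℍ) (s : ℂ) : ℂ :=
  (1 / 2 : ℂ) * ∑' p : {p : ℤ × ℤ // p ≠ (0, 0)},
    ((z.im : ℝ) : ℂ) ^ s /
      (((p.1.1 : ℂ) * (z : ℂ) + (p.1.2 : ℂ)) ^ k *
        ((‖(p.1.1 : ℂ) * (z : ℂ) + (p.1.2 : ℂ)‖ : ℝ) : ℂ) ^ (2 * s))

/-- The completed series `π^{-(s + k/2)} Γ(s + k/2 + |k|/2) E_k(z,s)`, as given by the series. -/
def completedSeries (k : ℤ) (z : ℍ) (s : ℂ) : ℂ :=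
  (Real.pi : ℂ) ^ (-(s + (k : ℂ) / 2)) *
    Complex.Gamma (s + (k : ℂ) / 2 + ((|k| : ℤ) : ℂ) / 2) * eisSeries k z s

/-- The doubly completed series `(s + k/2) (s + k/2 - 1)` times the completed one,
as given by the series. -/
def doublyCompletedSeries (k : ℤ) (z : ℍ) (s : ℂ) : ℂ :=
  (s + (k : ℂ) / 2) * (s + (k : ℂ) / 2 - 1) * completedSeries k z s

/-- `g` is an entire function that agrees with the doubly completed Eisenstein series of weight
`k` at `z` in the half-plane of absolute convergence. By the identity theorem there is at most one
such `g`. -/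
def IsEntireContinuation (k : ℤ) (z : ℍ) (g : ℂ → ℂ) : Prop :=
  Differentiable ℂ g ∧ ∀ s : ℂ, 1 - (k : ℝ) / 2 < s.re → g s = doublyCompletedSeries k z s

open Classical in
/-- The doubly completed Eisenstein series as an entire function of `s`: the analytic continuation
of `doublyCompletedSeries k z`. -/
def doublyCompletedEis (k : ℤ) (z : ℍ) : ℂ → ℂ :=
  if h : ∃ g : ℂ → ℂ, IsEntireContinuation k z g then h.choose else 0

/-- The `n`-th Taylor coefficient at `s = 0` of the doubly completed Eisenstein series of
weight `k`. -/
def taylorCoeff (k : ℤ) (n : ℕ) (z : ℍ) : ℂ :=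
  iteratedDeriv n (doublyCompletedEis k z) 0 / (n.factorial : ℂ)

/-- `G_{n,k}` (used for weights `k ≥ 2`). -/
def G (n : ℕ) (k : ℤ) : ℍ → ℂ := taylorCoeff k n

/-- `F_{n,k}` (used for weights `k ≤ 0`). -/
def F (n : ℕ) (k : ℤ) : ℍ → ℂ := taylorCoeff k n

/-- `∂f/∂x` for a function on the upper half-plane. -/
def partialX (f : ℍ → ℂ) (z : ℍ) : ℂ :=
  lineDeriv ℝ (fun w : ℂ => f (UpperHalfPlane.ofComplex w)) (z : ℂ) 1

/-- `∂f/∂y` for a function on the upper half-plane. -/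
def partialY (f : ℍ → ℂ) (z : ℍ) : ℂ :=
  lineDeriv ℝ (fun w : ℂ => f (UpperHalfPlane.ofComplex w)) (z : ℂ) Complex.I

/-- The Wirtinger derivative `∂f/∂z̄ = (1/2) (∂f/∂x + i ∂f/∂y)`. -/
def dbar (f : ℍ → ℂ) (z : ℍ) : ℂ :=
  (1 / 2 : ℂ) * (partialX f z + Complex.I * partialY f z)

/-- `ξ_k f = 2 i y^k` times the complex conjugate of `∂f/∂z̄`. -/
def xi (k : ℤ) (f : ℍ → ℂ) (z : ℍ) : ℂ :=
  2 * Complex.I * ((z.im : ℝ) : ℂ) ^ k * conj (dbar f z)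

/-- The weight `k` hyperbolic Laplacian
`Δ_k = y² (∂²/∂x² + ∂²/∂y²) - i k y (∂/∂x + i ∂/∂y)`. -/
def hypLaplacian (k : ℤ) (f : ℍ → ℂ) (z : ℍ) : ℂ :=
  ((z.im : ℝ) : ℂ) ^ 2 * (partialX (partialX f) z + partialY (partialY f) z)
    - Complex.I * (k : ℂ) * ((z.im : ℝ) : ℂ) * (partialX f z + Complex.I * partialY f z)

/-- `f` is a `C^∞` function of the two real variables `x, y` on the upper half-plane. -/
def IsSmooth (f : ℍ → ℂ) : Prop :=
  ContDiffOn ℝ ∞ (fun w : ℂ => f (UpperHalfPlane.ofComplex w)) {w : ℂ | 0 < w.im}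

/-- The connection equations for the constants `c n ℓ = c_{n,k,ℓ}`, with the conventions
`c_{n,k,0} = 1` and `c_{n,k,-1} = 0`. Only the values with `-1 ≤ ℓ ≤ n + 1` matter. -/
structure ConnectionEquations (k : ℤ) (c : ℕ → ℤ → ℂ) : Prop where
  zero : ∀ n : ℕ, c n 0 = 1
  neg_one : ∀ n : ℕ, c n (-1) = 0
  rec_eq : ∀ n : ℕ, 1 ≤ n → ∀ l : ℤ, 0 ≤ l → l ≤ n →
    c n l = 1 / ((k : ℂ) - 1) * c n (l - 1) + c (n - 1) l

/-- The modified function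
`G̃_{n,k} = G_{n,k} + ∑_{ℓ=1}^n (-1)^ℓ c_{n,k,ℓ} G_{n-ℓ,k}`. -/
def modG (k : ℤ) (c : ℕ → ℤ → ℂ) (n : ℕ) (z : ℍ) : ℂ :=
  G n k z + ∑ l ∈ Finset.Icc 1 n, (-1 : ℂ) ^ l * c n (l : ℤ) * G (n - l) k z

/-- The modified function `F̃_{n,2-k}`, which is `(-1)^n` times
`F_{n,2-k} + ∑_{ℓ=1}^n conj(c_{n,k,ℓ}) F_{n-ℓ,2-k}`; here `k` is the dual weight. -/
def modF (k : ℤ) (c : ℕ → ℤ → ℂ) (n : ℕ) (z : ℍ) : ℂ :=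
  (-1 : ℂ) ^ n *
    (F n (2 - k) z + ∑ l ∈ Finset.Icc 1 n, conj (c n (l : ℤ)) * F (n - l) (2 - k) z)

end PolyMaass

end

/-! Write `E_w` for the doubly completed series. Everything follows from two identities between
entire functions of `s`: `ξ_{2-k} E_{2-k}(z, s) = E_k(z, -s̄)` and `ξ_k E_k(z, s) = s̄ (s̄ + k - 1)
E_{2-k}(z, -s̄)`, proved as `dbarC_eisNonpos` and `dbarC_eisPos`. Comparing Taylor coefficients at
`s = 0` gives `ξ F_n = (-1)^n G_n` and `ξ G_n = (-1)^(n-1) (k - 1) F_{n-1} + (-1)^n F_{n-2}`, terms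
of negative index being zero. In `ξ_k G̃_n` the coefficient of `F_{n-1-ℓ}` is therefore `(-1)^(n-1)`
times the conjugate of `(k - 1) c_{n,ℓ} - c_{n,ℓ-1}`, and the connection equation says that this
bracket is `(k - 1) c_{n-1,ℓ}`. These are the ramp relations; the tower relations follow from `Δ_w =
ξ_{2-w} ξ_w`. The constant `c_{n,n+1}` is never on the left of a connection equation, hence is free.

For the two identities put `a = k - 2`, `u = m z + n`, `q = |u|² / y`. Up to elementary factors the
series of weights `-a` and `k` are Mellin transforms in `t` of `∑ u^a exp(-π t q)` and `∑ ū^k exp(-π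
t q)`. The inversion `t ↦ 1/t` of these theta series (`theta_inv`) comes from Poisson summation in
degree `0`, and each application of `∂/∂z̄` then raises the degree by two. Folding the Mellin
integral at `t = 1` leaves a rapidly convergent lattice sum, `entirePart`, which supplies both the
continuation in `s` and its functional equation.

The derivatives of a lattice sum `∑ u^b ū^c E(q)` are combinations of such sums. In weight `2 - k`
this is the first identity. In weight `k` the result has to be brought back to a spherical
polynomial by integrating by parts in `t`; the boundary terms at `t = 1` are evaluated by the
derivative of the theta inversion there (`theta_inv_deriv`).

Smoothness of the Taylor coefficients, and their commuting with `∂/∂z̄`, is obtained by letting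
lattice sums take values in a Banach space. With `s` on the unit circle they are smooth maps into
continuous functions on the circle, and by Cauchy's formula a Taylor coefficient is a continuous
linear functional of such a function. -/

noncomputable section
namespace PolyMaass

open Filter Topology

/-! ### Real-linear maps on `ℂ` in Wirtinger form -/

section Wirtinger

variable {B : Type*} [NormedAddCommGroup B] [NormedSpace ℂ B]

/-- The real-linear map `h ↦ h • v.1 + conj h • v.2`, as a continuous function of `v`. -/
def wirtingerL (B : Type*) [NormedAddCommGroup B] [NormedSpace ℂ B] :
    (B × B) →L[ℝ] (ℂ →L[ℝ] B) :=
  LinearMap.mkContinuous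
    { toFun := fun v => (ContinuousLinearMap.id ℝ ℂ).smulRight v.1 +
        (Complex.conjCLE : ℂ →L[ℝ] ℂ).smulRight v.2
      map_add' := fun v w => by ext h; simp; abel
      map_smul' := fun r v => by ext h; simp [smul_comm _ r] } 2 fun v => by
    refine ContinuousLinearMap.opNorm_le_bound _ (by positivity) fun h => ?_
    calc ‖h • v.1 + conj h • v.2‖ ≤ ‖h‖ * ‖v.1‖ + ‖h‖ * ‖v.2‖ := by
          refine (norm_add_le _ _).trans ?_
          rw [norm_smul, norm_smul, RCLike.norm_conj]
      _ ≤ ‖h‖ * ‖v‖ + ‖h‖ * ‖v‖ := by gcongr <;> [exact norm_fst_le v; exact norm_snd_le v]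
      _ = 2 * ‖v‖ * ‖h‖ := by ring

lemma wirtingerL_apply (v : B × B) (h : ℂ) : wirtingerL B v h = h • v.1 + conj h • v.2 := rfl

lemma norm_wirtingerL_le (v : B × B) : ‖wirtingerL B v‖ ≤ ‖v.1‖ + ‖v.2‖ := by
  refine ContinuousLinearMap.opNorm_le_bound _ (by positivity) fun h => ?_
  rw [wirtingerL_apply]
  refine (norm_add_le _ _).trans ?_
  rw [norm_smul, norm_smul, RCLike.norm_conj]
  exact le_of_eq (by ring)

/-- The Wirtinger derivative `∂f/∂z̄` of a vector-valued function on `ℂ`. -/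
def dbarC (f : ℂ → B) (z : ℂ) : B :=
  (1 / 2 : ℂ) • (fderiv ℝ f z 1 + Complex.I • fderiv ℝ f z Complex.I)

lemma dbarC_of_hasFDerivAt {f : ℂ → B} {v : B × B} {z : ℂ}
    (hf : HasFDerivAt f (wirtingerL B v) z) : dbarC f z = v.2 := by
  have h2 : Complex.I • Complex.I • v.1 = -v.1 := by
    rw [smul_smul, Complex.I_mul_I, neg_one_smul]
  have h3 : Complex.I • (-Complex.I) • v.2 = v.2 := by
    rw [smul_smul]; simp
  rw [dbarC, hf.fderiv, wirtingerL_apply, wirtingerL_apply]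
  simp only [map_one, one_smul, Complex.conj_I, smul_add, h2, h3]
  have : (1 / 2 : ℂ) • v.2 + (1 / 2 : ℂ) • v.2 = v.2 := by
    rw [← add_smul]; norm_num
  calc _ = (1 / 2 : ℂ) • v.2 + (1 / 2 : ℂ) • v.2 := by rw [smul_neg]; abel
    _ = v.2 := this

lemma dbarC_congr {f g : ℂ → B} {z : ℂ} (h : f =ᶠ[𝓝 z] g) : dbarC f z = dbarC g z := by
  rw [dbarC, dbarC, h.fderiv_eq]

lemma dbarC_const (b : B) (z : ℂ) : dbarC (fun _ => b) z = 0 := by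
  simp [dbarC]

lemma dbarC_const_smul {f : ℂ → B} {z : ℂ} (hf : DifferentiableAt ℝ f z) (a : ℂ) :
    dbarC (fun w => a • f w) z = a • dbarC f z := by
  have := (hf.hasFDerivAt.const_smul a).fderiv
  rw [dbarC, show (fun w => a • f w) = a • f from rfl, this]
  simp only [dbarC, smul_apply, smul_add, smul_comm a]

lemma dbarC_add {f g : ℂ → B} {z : ℂ} (hf : DifferentiableAt ℝ f z)
    (hg : DifferentiableAt ℝ g z) :
    dbarC (fun w => f w + g w) z = dbarC f z + dbarC g z := by
  have := (hf.hasFDerivAt.add hg.hasFDerivAt).fderiv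
  rw [dbarC, show (fun w => f w + g w) = f + g from rfl, this]
  simp only [dbarC, add_apply, smul_add]
  abel

lemma dbarC_clm {C : Type*} [NormedAddCommGroup C] [NormedSpace ℂ C] (T : B →L[ℂ] C)
    {f : ℂ → B} {z : ℂ} (hf : DifferentiableAt ℝ f z) :
    dbarC (fun w => T (f w)) z = T (dbarC f z) := by
  have h : HasFDerivAt (fun w => T (f w)) ((T.restrictScalars ℝ).comp (fderiv ℝ f z)) z :=
    (T.restrictScalars ℝ).hasFDerivAt.comp z hf.hasFDerivAt
  rw [dbarC, h.fderiv]
  simp [dbarC]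

end Wirtinger

/-! ### Lattice sums -/

/-- Nonzero pairs of integers. -/
abbrev Pairs : Type := {p : ℤ × ℤ // p ≠ (0, 0)}

/-- The lattice point `m z + n`. -/
def lin (p : ℤ × ℤ) (z : ℂ) : ℂ := (p.1 : ℂ) * z + (p.2 : ℂ)

/-- The quadratic form `|m z + n|² / y`. -/
def quad (p : ℤ × ℤ) (z : ℂ) : ℝ := Complex.normSq (lin p z) / z.im

section LatticeSum

variable {B : Type*} [NormedAddCommGroup B] [NormedSpace ℂ B]

/-- The summand of a lattice sum with a spherical polynomial and radial profile `E`. -/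
def latTerm (b c : ℕ) (E : ℝ → B) (z : ℂ) (p : ℤ × ℤ) : B :=
  (lin p z ^ b * conj (lin p z) ^ c) • E (quad p z)

/-- The lattice sum of `u ^ b * ū ^ c • E (|u|² / y)` over nonzero `u = m z + n`. -/
def latSum (b c : ℕ) (E : ℝ → B) (z : ℂ) : B := ∑' p : Pairs, latTerm b c E z p

/-- `E q = O(q ^ (-N))` on every half-line `[q₀, ∞)` with `q₀ > 0`. -/
def Decays (E : ℝ → B) (N : ℝ) : Prop :=
  ∀ q₀ > 0, ∃ C, ∀ q ≥ q₀, ‖E q‖ ≤ C * q ^ (-N)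

lemma one_le_norm_pairs (p : Pairs) : 1 ≤ ‖(p : ℤ × ℤ)‖ := by
  obtain ⟨⟨m, n⟩, h⟩ := p
  rw [Prod.norm_def]
  simp only [Int.norm_eq_abs, le_max_iff]
  have : m ≠ 0 ∨ n ≠ 0 := by by_contra! h'; exact h (by simp [h'])
  rcases this with h | h
  · left; exact_mod_cast Int.one_le_abs h
  · right; exact_mod_cast Int.one_le_abs h

lemma summable_norm_pairs {N : ℝ} (hN : 2 < N) :
    Summable fun p : Pairs => ‖(p : ℤ × ℤ)‖ ^ (-N) := by
  have h := EisensteinSeries.summable_one_div_norm_rpow hN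
  have h2 : Summable fun p : ℤ × ℤ => ‖p‖ ^ (-N) := by
    rw [← (finTwoArrowEquiv ℤ).summable_iff]
    refine h.congr fun x => ?_
    simp only [Function.comp, finTwoArrowEquiv_apply, EisensteinSeries.norm_eq_max_natAbs,
      Prod.norm_def]
    congr 1
    simp [Int.norm_eq_abs, Nat.cast_natAbs]
  exact h2.subtype _

lemma norm_lin_le (p : ℤ × ℤ) (z : ℂ) : ‖lin p z‖ ≤ (‖z‖ + 1) * ‖p‖ := by
  have h1 : ‖p.1‖ ≤ ‖p‖ := norm_fst_le p
  have h2 : ‖p.2‖ ≤ ‖p‖ := norm_snd_le p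
  calc ‖lin p z‖ ≤ ‖p.1‖ * ‖z‖ + ‖p.2‖ := by
        refine (norm_add_le _ _).trans ?_
        simp [Complex.norm_intCast, Int.norm_eq_abs]
    _ ≤ ‖p‖ * ‖z‖ + ‖p‖ := by gcongr
    _ = _ := by ring

/-- The imaginary part of `m z + n` controls `m`, and then `n = (m z + n) - m z` is controlled as
well. The constant is continuous in `z`, so it can be taken locally uniform. -/
lemma norm_le_lin (p : ℤ × ℤ) {z : ℂ} (hz : 0 < z.im) :
    ‖p‖ ≤ (1 / z.im + 1 + ‖z‖ / z.im) * ‖lin p z‖ := by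
  have h1 : ‖p.1‖ ≤ 1 / z.im * ‖lin p z‖ := by
    have : |(lin p z).im| ≤ ‖lin p z‖ := Complex.abs_im_le_norm _
    have h : (lin p z).im = p.1 * z.im := by simp [lin]
    rw [h, abs_mul, abs_of_pos hz] at this
    rw [Int.norm_eq_abs]
    field_simp
    exact this
  have h2 : ‖p.2‖ ≤ (1 + ‖z‖ / z.im) * ‖lin p z‖ := by
    have h : ((p.2 : ℤ) : ℂ) = lin p z - p.1 * z := by simp [lin]
    have : ‖p.2‖ = ‖((p.2 : ℤ) : ℂ)‖ := by simp [Complex.norm_intCast, Int.norm_eq_abs]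
    rw [this, h]
    refine (norm_sub_le _ _).trans ?_
    rw [norm_mul, show ‖((p.1 : ℤ) : ℂ)‖ = ‖p.1‖ by simp [Complex.norm_intCast, Int.norm_eq_abs]]
    calc ‖lin p z‖ + ‖p.1‖ * ‖z‖ ≤ ‖lin p z‖ + 1 / z.im * ‖lin p z‖ * ‖z‖ := by gcongr
      _ = _ := by ring
  rw [Prod.norm_def]
  have h3 : 0 ≤ ‖lin p z‖ := norm_nonneg _
  have h4 : 0 ≤ ‖z‖ / z.im * ‖lin p z‖ := by positivity
  have h5 : 0 ≤ 1 / z.im * ‖lin p z‖ := by positivity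
  apply max_le
  · refine h1.trans ?_
    nlinarith
  · refine h2.trans ?_
    nlinarith

lemma quad_pos (p : Pairs) {z : ℂ} (hz : 0 < z.im) : 0 < quad p z := by
  have h1 := one_le_norm_pairs p
  have h2 := norm_le_lin p hz
  have h3 : ‖lin p z‖ ≠ 0 := by
    intro h; rw [h] at h2; linarith
  exact div_pos (Complex.normSq_pos.2 (norm_ne_zero_iff.1 h3)) hz

lemma lin_ne_zero (p : Pairs) {z : ℂ} (hz : 0 < z.im) : lin p z ≠ 0 := by
  intro h
  have := quad_pos p hz
  simp [quad, h] at this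

/-- Near `z₀` both `|u|` and `√q` are comparable to `‖p‖`, with uniform constants: the polynomial
contributes `‖p‖ ^ (b + c)` and the profile `‖p‖ ^ (-2 N)`. -/
lemma eventually_latTerm_le {E : ℝ → B} {N : ℝ} (hN : 0 ≤ N) (hE : Decays E N) (b c : ℕ)
    {z₀ : ℂ} (hz₀ : 0 < z₀.im) :
    ∃ C, ∀ᶠ z in 𝓝 z₀, ∀ p : Pairs,
      ‖latTerm b c E z p‖ ≤ C * ‖(p : ℤ × ℤ)‖ ^ (-(2 * N - (b + c : ℕ))) := by
  set κ : ℂ → ℝ := fun z => 1 / z.im + 1 + ‖z‖ / z.im with hκ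
  have hκc : ContinuousAt κ z₀ := by
    have : z₀.im ≠ 0 := hz₀.ne'
    fun_prop (disch := assumption)
  set K := κ z₀ + 1
  have hK : 0 < K := by
    have : 0 < κ z₀ := by simp only [hκ]; positivity
    positivity
  set R := ‖z₀‖ + 1 + 1
  have hR : 0 < R := by positivity
  set Y := z₀.im + 1
  have hY : 0 < Y := by positivity
  -- All values `q` for `z` near `z₀` lie in this half-line, because `q ≥ ‖p‖² / (K² Y)` and `‖p‖ ≥
  -- 1`.
  obtain ⟨C, hC⟩ := hE ((K ^ 2 * Y)⁻¹) (by positivity)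
  have hC0 : 0 ≤ C := by
    have := (norm_nonneg _).trans (hC _ le_rfl)
    exact nonneg_of_mul_nonneg_left this (by positivity)
  refine ⟨R ^ (b + c) * (C * ((K ^ 2 * Y)⁻¹) ^ (-N)), ?_⟩
  have e1 : ∀ᶠ z in 𝓝 z₀, κ z < K := hκc.eventually (gt_mem_nhds (by simp [K]))
  have e2 : ∀ᶠ z in 𝓝 z₀, ‖z‖ + 1 < R :=
    (by fun_prop : ContinuousAt (fun z : ℂ => ‖z‖ + 1) z₀).eventually (gt_mem_nhds (by simp [R]))
  have e3 : ∀ᶠ z in 𝓝 z₀, z.im < Y :=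
    Complex.continuous_im.continuousAt.eventually (gt_mem_nhds (by simp [Y]))
  have e4 : ∀ᶠ z in 𝓝 z₀, 0 < z.im :=
    Complex.continuous_im.continuousAt.eventually (lt_mem_nhds hz₀)
  filter_upwards [e1, e2, e3, e4] with z h1 h2 h3 h4 p
  have hp := one_le_norm_pairs p
  have hp0 : 0 < ‖(p : ℤ × ℤ)‖ := by linarith
  have hlow : ‖(p : ℤ × ℤ)‖ ≤ K * ‖lin p z‖ := (norm_le_lin p h4).trans (by gcongr)
  have hup : ‖lin p z‖ ≤ R * ‖(p : ℤ × ℤ)‖ := (norm_lin_le p z).trans (by gcongr)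
  have hq : (K ^ 2 * Y)⁻¹ * ‖(p : ℤ × ℤ)‖ ^ 2 ≤ quad p z := by
    rw [quad, Complex.normSq_eq_norm_sq]
    calc (K ^ 2 * Y)⁻¹ * ‖(p : ℤ × ℤ)‖ ^ 2 ≤ (K ^ 2 * Y)⁻¹ * (K * ‖lin p z‖) ^ 2 := by gcongr
      _ = ‖lin p z‖ ^ 2 / Y := by field_simp
      _ ≤ ‖lin p z‖ ^ 2 / z.im := by gcongr
  have hq0 : (K ^ 2 * Y)⁻¹ ≤ quad p z :=
    (le_mul_of_one_le_right (by positivity) (one_le_pow₀ hp)).trans hq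
  have hEq := hC _ hq0
  have hrp : quad p z ^ (-N) ≤ ((K ^ 2 * Y)⁻¹) ^ (-N) * ‖(p : ℤ × ℤ)‖ ^ (-(2 * N)) := by
    calc quad p z ^ (-N) ≤ ((K ^ 2 * Y)⁻¹ * ‖(p : ℤ × ℤ)‖ ^ 2) ^ (-N) :=
          Real.rpow_le_rpow_of_nonpos (by positivity) hq (by linarith)
      _ = _ := by
        rw [Real.mul_rpow (by positivity) (by positivity), ← Real.rpow_natCast ‖(p : ℤ × ℤ)‖ 2,
          ← Real.rpow_mul hp0.le]
        congr 2; push_cast; ring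
  rw [latTerm, norm_smul, norm_mul, norm_pow, norm_pow, RCLike.norm_conj, ← pow_add]
  calc ‖lin p z‖ ^ (b + c) * ‖E (quad p z)‖
      ≤ (R * ‖(p : ℤ × ℤ)‖) ^ (b + c) *
          (C * (((K ^ 2 * Y)⁻¹) ^ (-N) * ‖(p : ℤ × ℤ)‖ ^ (-(2 * N)))) := by
        gcongr
        exact hEq.trans (by gcongr)
    _ = R ^ (b + c) * (C * ((K ^ 2 * Y)⁻¹) ^ (-N)) *
          (‖(p : ℤ × ℤ)‖ ^ ((b + c : ℕ) : ℝ) * ‖(p : ℤ × ℤ)‖ ^ (-(2 * N))) := by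
        rw [mul_pow, Real.rpow_natCast]; ring
    _ = _ := by
        rw [← Real.rpow_add hp0]
        congr 2; ring

lemma summable_latTerm [CompleteSpace B] {E : ℝ → B} {N : ℝ} (hE : Decays E N) {b c : ℕ}
    (hN : 2 + (b + c : ℕ) < 2 * N) {z : ℂ} (hz : 0 < z.im) :
    Summable fun p : Pairs => ‖latTerm b c E z p‖ := by
  have hN0 : 0 ≤ N := by
    have : (0 : ℝ) ≤ (b + c : ℕ) := Nat.cast_nonneg _
    linarith
  obtain ⟨C, hC⟩ := eventually_latTerm_le hN0 hE b c hz
  refine Summable.of_nonneg_of_le (fun _ => norm_nonneg _) (fun p => hC.self_of_nhds p)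
    ((summable_norm_pairs ?_).mul_left C)
  linarith

end LatticeSum

/-! ### Wirtinger derivatives of the summands -/

section LatticeSumDeriv

variable {B : Type*} [NormedAddCommGroup B] [NormedSpace ℂ B]

/-- The coefficients of the derivative of a lattice sum, built from a family `T b c E`
that stands for the summands or for the sums. -/
def latDeriv (T : ℕ → ℕ → (ℝ → B) → B) (b c : ℕ) (E E' : ℝ → B) (y : ℝ) : B × B :=
  (((b : ℂ) / (2 * Complex.I * y)) • (T b c E - T (b - 1) (c + 1) E) +
      (Complex.I / (2 * (y : ℂ) ^ 2)) • T b (c + 2) E',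
    ((c : ℂ) / (2 * Complex.I * y)) • (T (b + 1) (c - 1) E - T b c E) -
      (Complex.I / (2 * (y : ℂ) ^ 2)) • T (b + 2) c E')

lemma hasFDerivAt_lin (p : ℤ × ℤ) (z : ℂ) :
    HasFDerivAt (lin p) (wirtingerL ℂ ((p.1 : ℂ), 0)) z := by
  have h : HasDerivAt (lin p) ((p.1 : ℂ) * 1) z :=
    ((hasDerivAt_id z).const_mul (p.1 : ℂ)).add_const _
  refine (h.hasFDerivAt.restrictScalars ℝ).congr_fderiv ?_
  ext h; simp [wirtingerL_apply]

lemma hasFDerivAt_conj_lin (p : ℤ × ℤ) (z : ℂ) :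
    HasFDerivAt (fun z => conj (lin p z)) (wirtingerL ℂ (0, (p.1 : ℂ))) z := by
  refine ((Complex.conjCLE : ℂ →L[ℝ] ℂ).hasFDerivAt.comp z (hasFDerivAt_lin p z)).congr_fderiv ?_
  ext h; simp [wirtingerL_apply]

lemma mul_conj_lin (p : ℤ × ℤ) {z : ℂ} (hz : 0 < z.im) :
    lin p z * conj (lin p z) = z.im * quad p z := by
  have : (z.im : ℂ) ≠ 0 := by exact_mod_cast hz.ne'
  rw [Complex.mul_conj, quad]
  push_cast
  field_simp

lemma lin_sub_conj (p : ℤ × ℤ) (z : ℂ) :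
    lin p z - conj (lin p z) = 2 * Complex.I * z.im * p.1 := by
  have : z - conj z = 2 * z.im * Complex.I := by rw [Complex.sub_conj]; push_cast; ring
  simp only [lin, map_add, map_mul, map_intCast]
  linear_combination (p.1 : ℂ) * this

lemma hasFDerivAt_im (z : ℂ) :
    HasFDerivAt (fun z : ℂ => (z.im : ℂ)) (wirtingerL ℂ (-Complex.I / 2, Complex.I / 2)) z := by
  refine (Complex.ofRealCLM.comp Complex.imCLM).hasFDerivAt.congr_fderiv ?_
  ext h
  have h2 : h - conj h = 2 * h.im * Complex.I := by rw [Complex.sub_conj]; push_cast; ring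
  simp only [wirtingerL_apply, smul_eq_mul, ContinuousLinearMap.comp_apply,
    Complex.imCLM_apply, Complex.ofRealCLM_apply]
  linear_combination (-1 : ℂ) * ( (-Complex.I / 2) * h2 - (h.im : ℂ) * Complex.I_sq)

lemma hasFDerivAt_ofReal_quad (p : ℤ × ℤ) {z : ℂ} (hz : 0 < z.im) :
    HasFDerivAt (fun z => (quad p z : ℂ))
      (wirtingerL ℂ (Complex.I / (2 * (z.im : ℂ) ^ 2) * conj (lin p z) ^ 2,
        -(Complex.I / (2 * (z.im : ℂ) ^ 2)) * lin p z ^ 2)) z := by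
  have hy : (z.im : ℂ) ≠ 0 := by exact_mod_cast hz.ne'
  have h1 := (hasFDerivAt_lin p z).mul (hasFDerivAt_conj_lin p z)
  have h2 := (hasDerivAt_inv hy).comp_hasFDerivAt z (hasFDerivAt_im z)
  have h3 := h1.mul h2
  have h4 : (fun z : ℂ => (quad p z : ℂ)) =
      (lin p * fun z => conj (lin p z)) * (Inv.inv ∘ fun z : ℂ => (z.im : ℂ)) := by
    ext w
    simp [quad, Complex.mul_conj, div_eq_mul_inv]
  rw [h4]
  refine h3.congr_fderiv ?_
  ext h
  have hI : (p.1 : ℂ) = (lin p z - conj (lin p z)) / (2 * Complex.I * z.im) := by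
    rw [lin_sub_conj]; field_simp
  simp only [wirtingerL_apply, smul_eq_mul, add_apply, smul_apply, Pi.mul_apply,
    Function.comp_apply, hI]
  field_simp
  ring_nf
  simp only [Complex.I_sq]
  ring

/-- The profile is a function of a real variable, so the chain rule needs the derivative of `q` as a
real functional. It exists because the two Wirtinger coefficients are conjugate to each other. -/
lemma hasFDerivAt_quad (p : ℤ × ℤ) {z : ℂ} (hz : 0 < z.im) :
    ∃ D : ℂ →L[ℝ] ℝ, HasFDerivAt (quad p) D z ∧ ∀ h, (D h : ℂ) =
      wirtingerL ℂ (Complex.I / (2 * (z.im : ℂ) ^ 2) * conj (lin p z) ^ 2,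
        -(Complex.I / (2 * (z.im : ℂ) ^ 2)) * lin p z ^ 2) h := by
  have h := hasFDerivAt_ofReal_quad p hz
  have h2 := Complex.reCLM.hasFDerivAt.comp z h
  refine ⟨_, h2, fun w => ?_⟩
  simp only [ContinuousLinearMap.comp_apply, Complex.reCLM_apply]
  rw [← Complex.conj_eq_iff_re]
  simp only [wirtingerL_apply, smul_eq_mul, map_add, map_mul, map_neg, map_div₀, Complex.conj_I,
    map_pow, Complex.conj_conj, Complex.conj_ofReal, map_ofNat]
  ring

/-- Differentiating `u` produces the integer `m`. Replacing it by `(u - ū) / (2 i y)` keeps the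
derivative within the same family of summands, with coefficients that depend on `y` alone. -/
lemma hasFDerivAt_latTerm (p : ℤ × ℤ) (b c : ℕ) {E E' : ℝ → B} {z : ℂ} (hz : 0 < z.im)
    (hE : HasDerivAt E (E' (quad p z)) (quad p z)) :
    HasFDerivAt (fun z => latTerm b c E z p)
      (wirtingerL B (latDeriv (fun b c E => latTerm b c E z p) b c E E' z.im)) z := by
  have hy : (z.im : ℂ) ≠ 0 := by exact_mod_cast hz.ne'
  obtain ⟨D, hD, hD'⟩ := hasFDerivAt_quad p hz
  have h1 := ((hasFDerivAt_lin p z).pow b).mul ((hasFDerivAt_conj_lin p z).pow c)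
  have h2 := hE.hasFDerivAt.comp z hD
  have h3 := h1.smul h2
  have h4 : (fun z => latTerm b c E z p) =
      (fun z => (lin p z ^ b * conj (lin p z) ^ c) • E (quad p z)) := by
    ext w; simp [latTerm]
  rw [h4]
  refine HasFDerivAt.congr_fderiv h3 ?_
  ext h
  have hI : (p.1 : ℂ) = (lin p z - conj (lin p z)) / (2 * Complex.I * z.im) := by
    rw [lin_sub_conj]; field_simp
  have hD2 : D h • E' (quad p z) = (D h : ℂ) • E' (quad p z) := by
    rw [Complex.coe_smul]
  simp only [add_apply, smul_apply, ContinuousLinearMap.comp_apply,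
    ContinuousLinearMap.smulRight_apply, wirtingerL_apply, latDeriv, latTerm, hD2, hD', hI,
    ContinuousLinearMap.toSpanSingleton_apply, Function.comp_apply, smul_eq_mul, Pi.mul_apply]
  rcases b with _ | b <;> rcases c with _ | c
  all_goals
    simp only [Nat.add_sub_cancel, Nat.cast_zero, zero_smul, zero_mul, mul_zero, zero_div]
    match_scalars <;> · push_cast; field_simp; try ring

end LatticeSumDeriv

/-! ### Termwise differentiation of lattice sums -/

section LatticeSumDiff

variable {B : Type*} [NormedAddCommGroup B] [NormedSpace ℂ B]

lemma eventually_latTerm_le_of_le {E : ℝ → B} {N M : ℝ} (hN : 0 ≤ N) (hE : Decays E N) (b c : ℕ)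
    (hM : M ≤ 2 * N - (b + c : ℕ)) {z₀ : ℂ} (hz₀ : 0 < z₀.im) :
    ∃ C ≥ 0, ∀ᶠ z in 𝓝 z₀, ∀ p : Pairs,
      ‖latTerm b c E z p‖ ≤ C * ‖(p : ℤ × ℤ)‖ ^ (-M) := by
  obtain ⟨C, hC⟩ := eventually_latTerm_le hN hE b c hz₀
  refine ⟨max C 0, le_max_right _ _, ?_⟩
  filter_upwards [hC] with z hz p
  refine (hz p).trans ?_
  have hp := one_le_norm_pairs p
  have h1 : ‖(p : ℤ × ℤ)‖ ^ (-(2 * N - (b + c : ℕ))) ≤ ‖(p : ℤ × ℤ)‖ ^ (-M) :=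
    Real.rpow_le_rpow_of_exponent_le hp (by linarith)
  have h2 : 0 ≤ ‖(p : ℤ × ℤ)‖ ^ (-(2 * N - (b + c : ℕ))) := by positivity
  calc _ ≤ max C 0 * ‖(p : ℤ × ℤ)‖ ^ (-(2 * N - (b + c : ℕ))) := by gcongr; exact le_max_left _ _
    _ ≤ _ := by gcongr

lemma norm_latDeriv_le (T : ℕ → ℕ → (ℝ → B) → B) (b c : ℕ) (E E' : ℝ → B) (y : ℝ) :
    ‖wirtingerL B (latDeriv T b c E E' y)‖ ≤
      (‖(b : ℂ) / (2 * Complex.I * y)‖ + ‖(c : ℂ) / (2 * Complex.I * y)‖ +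
        ‖Complex.I / (2 * (y : ℂ) ^ 2)‖) *
      (‖T b c E‖ + ‖T (b - 1) (c + 1) E‖ + ‖T b (c + 2) E'‖ +
        (‖T (b + 1) (c - 1) E‖ + ‖T b c E‖ + ‖T (b + 2) c E'‖)) := by
  refine (norm_wirtingerL_le _).trans ?_
  rw [mul_add]
  simp only [latDeriv]
  refine add_le_add ?_ ?_
  · refine (norm_add_le _ _).trans ?_
    rw [norm_smul, norm_smul, mul_add]
    refine add_le_add ?_ ?_
    · gcongr ?_ * ?_
      · linarith [norm_nonneg ((c : ℂ) / (2 * Complex.I * y)),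
          norm_nonneg (Complex.I / (2 * (y : ℂ) ^ 2))]
      · exact norm_sub_le _ _
    · gcongr
      linarith [norm_nonneg ((c : ℂ) / (2 * Complex.I * y)),
          norm_nonneg ((b : ℂ) / (2 * Complex.I * y))]
  · refine (norm_sub_le _ _).trans ?_
    rw [norm_smul, norm_smul, mul_add]
    refine add_le_add ?_ ?_
    · gcongr ?_ * ?_
      · linarith [norm_nonneg ((b : ℂ) / (2 * Complex.I * y)),
          norm_nonneg (Complex.I / (2 * (y : ℂ) ^ 2))]
      · exact norm_sub_le _ _
    · gcongr
      linarith [norm_nonneg ((c : ℂ) / (2 * Complex.I * y)),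
          norm_nonneg ((b : ℂ) / (2 * Complex.I * y))]

/-- The terms with `E'` have degree higher by two, which the extra order of decay of `E'` pays for.
-/
lemma hasFDerivAt_latSum [CompleteSpace B] {b c : ℕ} {E E' : ℝ → B} {N : ℝ}
    (hN : 3 + (b + c : ℕ) < 2 * N) (hE : ∀ q > 0, HasDerivAt E (E' q) q)
    (hd : Decays E N) (hd' : Decays E' (N + 1)) {z : ℂ} (hz : 0 < z.im) :
    HasFDerivAt (latSum b c E)
      (wirtingerL B (latDeriv (fun b c E => latSum b c E z) b c E E' z.im)) z := by
  have hN0 : 0 ≤ N := by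
    have : (0 : ℝ) ≤ (b + c : ℕ) := Nat.cast_nonneg _
    linarith
  -- One exponent serves all five kinds of terms. The extra `1` is for truncated subtraction: when
  -- `b = 0` the pair `(b - 1, c + 1)` has degree `b + c + 1`, and similarly when `c = 0`.
  set M : ℝ := 2 * N - (b + c : ℕ) - 1 with hM
  have hM2 : 2 < M := by linarith
  have hbc : (((b + c : ℕ) : ℕ) : ℝ) = b + c := by push_cast; ring
  obtain ⟨C₁, hC₁0, hC₁⟩ := eventually_latTerm_le_of_le (M := M) hN0 hd b c (by linarith) hz
  obtain ⟨C₂, hC₂0, hC₂⟩ := eventually_latTerm_le_of_le (M := M) hN0 hd (b - 1) (c + 1) (by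
    have : (((b - 1 + (c + 1) : ℕ)) : ℝ) ≤ (b + c : ℕ) + 1 := by
      exact_mod_cast (by omega : b - 1 + (c + 1) ≤ b + c + 1)
    linarith) hz
  obtain ⟨C₃, hC₃0, hC₃⟩ := eventually_latTerm_le_of_le (M := M) (by linarith) hd' b (c + 2)
    (by push_cast at hM ⊢; linarith) hz
  obtain ⟨C₄, hC₄0, hC₄⟩ := eventually_latTerm_le_of_le (M := M) hN0 hd (b + 1) (c - 1) (by
    have : (((b + 1 + (c - 1) : ℕ)) : ℝ) ≤ (b + c : ℕ) + 1 := by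
      exact_mod_cast (by omega : b + 1 + (c - 1) ≤ b + c + 1)
    linarith) hz
  obtain ⟨C₅, hC₅0, hC₅⟩ := eventually_latTerm_le_of_le (M := M) (by linarith) hd' (b + 2) c
    (by push_cast at hM ⊢; linarith) hz
  set α : ℂ → ℝ := fun z => ‖(b : ℂ) / (2 * Complex.I * z.im)‖ +
    ‖(c : ℂ) / (2 * Complex.I * z.im)‖ + ‖Complex.I / (2 * (z.im : ℂ) ^ 2)‖ with hα
  have hαc : ContinuousAt α z := by
    have h1 : 2 * Complex.I * z.im ≠ 0 := by simp [hz.ne']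
    have h2 : (2 * (z.im : ℂ) ^ 2) ≠ 0 := by simp [hz.ne']
    simp only [hα]
    fun_prop (disch := assumption)
  have hαe : ∀ᶠ w in 𝓝 z, α w ≤ α z + 1 :=
    (hαc.eventually (gt_mem_nhds (lt_add_one (α z)))).mono fun _ h => le_of_lt h
  have hα0 : ∀ w, 0 ≤ α w := fun w => by simp only [hα]; positivity
  have him : ∀ᶠ w : ℂ in 𝓝 z, 0 < w.im :=
    Complex.continuous_im.continuousAt.eventually (lt_mem_nhds hz)
  obtain ⟨r, hr, hball⟩ := Metric.eventually_nhds_iff_ball.1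
    (hC₁.and (hC₂.and (hC₃.and (hC₄.and (hC₅.and (hαe.and him))))))
  have hzb : z ∈ Metric.ball z r := Metric.mem_ball_self hr
  have hsum0 := summable_norm_pairs hM2
  have main := hasFDerivAt_tsum_of_isPreconnected (𝕜 := ℝ)
    (u := fun p : Pairs => (α z + 1) * (C₁ + C₂ + C₃ + (C₄ + C₁ + C₅)) * ‖(p : ℤ × ℤ)‖ ^ (-M))
    (f := fun (p : Pairs) w => latTerm b c E w p)
    (f' := fun (p : Pairs) w =>
      wirtingerL B (latDeriv (fun b c E => latTerm b c E w p) b c E E' w.im))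
    (hsum0.mul_left _) Metric.isOpen_ball (convex_ball z r).isPreconnected
    (fun p w hw => hasFDerivAt_latTerm p b c (hball w hw).2.2.2.2.2.2
      (hE _ (quad_pos p (hball w hw).2.2.2.2.2.2)))
    (fun p w hw => by
      obtain ⟨h1, h2, h3, h4, h5, h6, h7⟩ := hball w hw
      refine (norm_latDeriv_le _ _ _ _ _ _).trans ?_
      rw [mul_assoc (α z + 1)]
      refine mul_le_mul h6 ?_ (by positivity) (by linarith [hα0 z])
      rw [add_mul, add_mul, add_mul, add_mul, add_mul]
      gcongr
      exacts [h1 p, h2 p, h3 p, h4 p, h1 p, h5 p])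
    hzb (hsum0.mul_left C₁ |>.of_norm_bounded fun p => (hball z hzb).1 p) hzb
  refine main.congr_fderiv ?_
  have hs : ∀ {b' c' : ℕ} {F : ℝ → B} {C : ℝ} (_ : ∀ p : Pairs,
      ‖latTerm b' c' F z p‖ ≤ C * ‖(p : ℤ × ℤ)‖ ^ (-M)),
      HasSum (fun p : Pairs => latTerm b' c' F z p) (latSum b' c' F z) := fun h =>
    (hsum0.mul_left _ |>.of_norm_bounded h).hasSum
  obtain ⟨h1, h2, h3, h4, h5, h6, h7⟩ := hball z hzb
  have hA := (((hs h1).sub (hs h2)).const_smul ((b : ℂ) / (2 * Complex.I * z.im))).add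
    ((hs h3).const_smul (Complex.I / (2 * (z.im : ℂ) ^ 2)))
  have hB := (((hs h4).sub (hs h1)).const_smul ((c : ℂ) / (2 * Complex.I * z.im))).sub
    ((hs h5).const_smul (Complex.I / (2 * (z.im : ℂ) ^ 2)))
  exact ((hA.prodMk hB).mapL (wirtingerL B)).tsum_eq

lemma dbarC_latSum [CompleteSpace B] {b c : ℕ} {E E' : ℝ → B} {N : ℝ}
    (hN : 3 + (b + c : ℕ) < 2 * N) (hE : ∀ q > 0, HasDerivAt E (E' q) q)
    (hd : Decays E N) (hd' : Decays E' (N + 1)) {z : ℂ} (hz : 0 < z.im) :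
    dbarC (latSum b c E) z =
      ((c : ℂ) / (2 * Complex.I * z.im)) • (latSum (b + 1) (c - 1) E z - latSum b c E z) -
        (Complex.I / (2 * (z.im : ℂ) ^ 2)) • latSum (b + 2) c E' z :=
  dbarC_of_hasFDerivAt (hasFDerivAt_latSum hN hE hd hd' hz)

end LatticeSumDiff

end PolyMaass

end

noncomputable section
namespace PolyMaass

open Filter Topology MeasureTheory Set

/-! ### Profiles given by incomplete Laplace transforms, and smoothness of their lattice sums -/

section Laplace

lemma decays_exp_neg {a : ℝ} (ha : 0 < a) (M : ℝ) :
    Decays (fun q => (Real.exp (-a * q) : ℂ)) M := by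
  intro q₀ hq₀
  have h1 := (isLittleO_exp_neg_mul_rpow_atTop ha (-M)).bound one_pos
  obtain ⟨q₁, hq₁⟩ := eventually_atTop.1 h1
  have hc : ContinuousOn (fun q : ℝ => q ^ M * Real.exp (-a * q)) (Icc q₀ q₁) := by
    intro q hq
    have : q ≠ 0 := by have := hq.1; linarith
    have h : ContinuousAt (fun q : ℝ => q ^ M * Real.exp (-a * q)) q := by
      fun_prop (disch := simp [this])
    exact h.continuousWithinAt
  obtain ⟨C, hC⟩ := isCompact_Icc.exists_bound_of_continuousOn hc
  refine ⟨max C 1, fun q hq => ?_⟩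
  have hq0 : 0 < q := by linarith
  have hpos : 0 < q ^ (-M) := Real.rpow_pos_of_pos hq0 _
  rw [Complex.norm_real, Real.norm_of_nonneg (Real.exp_pos _).le]
  rcases le_total q q₁ with h | h
  · have := hC q ⟨hq, h⟩
    rw [Real.norm_of_nonneg (by positivity)] at this
    calc Real.exp (-a * q) = (q ^ M * Real.exp (-a * q)) * q ^ (-M) := by
          rw [Real.rpow_neg hq0.le]; field_simp
      _ ≤ max C 1 * q ^ (-M) := by gcongr; exact this.trans (le_max_left _ _)
  · have := hq₁ q h
    rw [Real.norm_of_nonneg (Real.exp_pos _).le, Real.norm_of_nonneg hpos.le] at this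
    exact this.trans (by gcongr; exact le_max_right _ _)

lemma Decays.const_smul {B : Type*} [NormedAddCommGroup B] [NormedSpace ℂ B] {E : ℝ → B} {N : ℝ}
    (h : Decays E N) (a : ℂ) : Decays (fun q => a • E q) N := fun q₀ hq₀ => by
  obtain ⟨C, hC⟩ := h q₀ hq₀
  refine ⟨‖a‖ * C, fun q hq => ?_⟩
  rw [norm_smul, mul_assoc]
  exact mul_le_mul_of_nonneg_left (hC q hq) (norm_nonneg _)

variable {B : Type*} [NormedAddCommGroup B] [NormedSpace ℂ B]

/-- Continuity and polynomial growth on `(1, ∞)`. -/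
structure PolyGrowth (W : ℝ → B) : Prop where
  cont : ContinuousOn W (Ioi 1)
  bound : ∃ (C : ℝ) (n : ℕ), 0 ≤ C ∧ ∀ t > 1, ‖W t‖ ≤ C * t ^ n

/-- The incomplete Laplace transform `∫_{t > 1} exp (-π t q) W(t) dt`. -/
def lap (W : ℝ → B) (q : ℝ) : B := ∫ t in Ioi (1 : ℝ), Real.exp (-(Real.pi * q) * t) • W t

lemma integrableOn_pow_mul_exp (n : ℕ) {a : ℝ} (ha : 0 < a) :
    IntegrableOn (fun t : ℝ => t ^ n * Real.exp (-a * t)) (Ioi 1) := by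
  have h := integrableOn_rpow_mul_exp_neg_mul_rpow (s := n) (p := 1) (b := a)
    (by have : (0 : ℝ) ≤ n := n.cast_nonneg
        linarith) one_pos ha
  simp only [Real.rpow_natCast, Real.rpow_one] at h
  exact h.mono_set (Ioi_subset_Ioi zero_le_one)

lemma PolyGrowth.integrableOn {W : ℝ → B} (hW : PolyGrowth W) {a : ℝ} (ha : 0 < a) :
    IntegrableOn (fun t => Real.exp (-a * t) • W t) (Ioi 1) := by
  obtain ⟨C, n, hC0, hC⟩ := hW.bound
  refine Integrable.mono' ((integrableOn_pow_mul_exp n ha).const_mul C) ?_ ?_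
  · refine ContinuousOn.aestronglyMeasurable ?_ measurableSet_Ioi
    exact (by fun_prop : Continuous fun t : ℝ => Real.exp (-a * t)).continuousOn.smul hW.cont
  · refine (ae_restrict_mem measurableSet_Ioi).mono fun t ht => ?_
    rw [norm_smul, Real.norm_of_nonneg (Real.exp_pos _).le]
    calc _ ≤ Real.exp (-a * t) * (C * t ^ n) := by gcongr; exact hC t ht
      _ = _ := by ring

lemma PolyGrowth.mul_self {W : ℝ → B} (hW : PolyGrowth W) :
    PolyGrowth fun t => (-(Real.pi * t)) • W t where
  cont := (by fun_prop : Continuous fun t : ℝ => -(Real.pi * t)).continuousOn.smul hW.cont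
  bound := by
    obtain ⟨C, n, hC0, hC⟩ := hW.bound
    refine ⟨Real.pi * C, n + 1, by positivity, fun t ht => ?_⟩
    have ht0 : (0 : ℝ) < t := by linarith
    rw [norm_smul, norm_neg, Real.norm_of_nonneg (by positivity)]
    calc _ ≤ Real.pi * t * (C * t ^ n) := by gcongr; exact hC t ht
      _ = _ := by ring

lemma hasDerivAt_lap {W : ℝ → B} (hW : PolyGrowth W) {q : ℝ} (hq : 0 < q) :
    HasDerivAt (lap W) (lap (fun t => (-(Real.pi * t)) • W t) q) q := by
  obtain ⟨C, n, hC0, hC⟩ := hW.mul_self.bound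
  have hpi := Real.pi_pos
  have hmeas : ∀ (V : ℝ → B), PolyGrowth V → ∀ x : ℝ, AEStronglyMeasurable
      (fun t => Real.exp (-(Real.pi * x) * t) • V t) (volume.restrict (Ioi 1)) := fun V hV x =>
    ContinuousOn.aestronglyMeasurable ((by fun_prop : Continuous fun t : ℝ =>
      Real.exp (-(Real.pi * x) * t)).continuousOn.smul hV.cont) measurableSet_Ioi
  refine (hasDerivAt_integral_of_dominated_loc_of_deriv_le (𝕜 := ℝ)
    (μ := volume.restrict (Ioi (1 : ℝ)))
    (F := fun x t => Real.exp (-(Real.pi * x) * t) • W t)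
    (F' := fun x t => Real.exp (-(Real.pi * x) * t) • (-(Real.pi * t)) • W t)
    (bound := fun t => C * (t ^ n * Real.exp (-(Real.pi * (q / 2)) * t)))
    (Ioi_mem_nhds (by linarith : q / 2 < q)) (Eventually.of_forall (hmeas W hW))
    (hW.integrableOn (by positivity)) (hmeas _ hW.mul_self q) ?_
    ((integrableOn_pow_mul_exp n (by positivity)).const_mul C) ?_).2
  · refine (ae_restrict_mem measurableSet_Ioi).mono fun t ht x hx => ?_
    have ht : 1 < t := ht
    have hx : q / 2 < x := hx
    rw [norm_smul, Real.norm_of_nonneg (Real.exp_pos _).le]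
    calc _ ≤ Real.exp (-(Real.pi * (q / 2)) * t) * (C * t ^ n) := by
          gcongr
          exact hC t ht
      _ = _ := by ring
  · refine Eventually.of_forall fun t x _ => ?_
    have h : HasDerivAt (fun x : ℝ => Real.exp (-(Real.pi * x) * t))
        (Real.exp (-(Real.pi * x) * t) * (-(Real.pi * t))) x := by
      have : HasDerivAt (fun x : ℝ => -(Real.pi * x) * t) (-(Real.pi * 1) * t) x :=
        (((hasDerivAt_id x).const_mul Real.pi).neg).mul_const t
      convert this.exp using 1
      ring
    have := h.smul_const (W t)
    rwa [mul_smul] at this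

/-- For `t > 1` half of the exponent makes the integral in `t` converge uniformly in `q ≥ q₀`, and
the other half gives exponential decay in `q`. -/
lemma norm_lap_le {W : ℝ → B} {C : ℝ} {n : ℕ} (hC : ∀ t > 1, ‖W t‖ ≤ C * t ^ n)
    {q₀ : ℝ} (hq₀ : 0 < q₀) {q : ℝ} (hq : q₀ ≤ q) :
    ∫ t in Ioi (1 : ℝ), ‖Real.exp (-(Real.pi * q) * t) • W t‖ ≤
      C * (∫ t in Ioi (1 : ℝ), t ^ n * Real.exp (-(Real.pi * q₀ / 2) * t)) *
        Real.exp (-(Real.pi / 2) * q) := by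
  have hpi := Real.pi_pos
  rw [← integral_const_mul, ← integral_mul_const]
  refine integral_mono_of_nonneg (Eventually.of_forall fun _ => norm_nonneg _)
    (((integrableOn_pow_mul_exp n (by positivity)).const_mul C).mul_const _) ?_
  refine (ae_restrict_mem measurableSet_Ioi).mono fun t ht => ?_
  have ht : 1 < t := ht
  have ht0 : 0 < t := by linarith
  simp only
  rw [norm_smul, Real.norm_of_nonneg (Real.exp_pos _).le]
  have h1 : Real.exp (-(Real.pi * q) * t) ≤
      Real.exp (-(Real.pi * q₀ / 2) * t) * Real.exp (-(Real.pi / 2) * q) := by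
    rw [← Real.exp_add]
    gcongr
    have h2 : q₀ * t ≤ q * t := by gcongr
    have h3 : q * 1 ≤ q * t := by gcongr; linarith
    nlinarith
  calc _ ≤ (Real.exp (-(Real.pi * q₀ / 2) * t) * Real.exp (-(Real.pi / 2) * q)) *
        (C * t ^ n) := by gcongr; exact hC t ht
    _ = _ := by ring

/-- The integral of the norm, rather than the norm of the integral, is what the exchange of sum and
integral in `integral_mul_latSum_gauss` requires. -/
lemma decays_integral_norm {W : ℝ → B} (hW : PolyGrowth W) (M : ℝ) :
    Decays (fun q => ((∫ t in Ioi (1 : ℝ), ‖Real.exp (-(Real.pi * q) * t) • W t‖ : ℝ) : ℂ)) M := by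
  intro q₀ hq₀
  obtain ⟨C, n, hC0, hC⟩ := hW.bound
  obtain ⟨C', hC'⟩ := decays_exp_neg (a := Real.pi / 2) (by positivity) M q₀ hq₀
  set K := C * ∫ t in Ioi (1 : ℝ), t ^ n * Real.exp (-(Real.pi * q₀ / 2) * t)
  have hK : 0 ≤ K := by
    refine mul_nonneg hC0 (setIntegral_nonneg measurableSet_Ioi fun t (ht : 1 < t) => ?_)
    have : 0 < t := by linarith
    positivity
  refine ⟨K * C', fun q hq => ?_⟩
  have := hC' q hq
  rw [Complex.norm_real, Real.norm_of_nonneg (Real.exp_pos _).le] at this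
  rw [Complex.norm_real, Real.norm_of_nonneg (integral_nonneg fun _ => norm_nonneg _), mul_assoc]
  exact (norm_lap_le hC hq₀ hq).trans (by gcongr)

lemma decays_lap {W : ℝ → B} (hW : PolyGrowth W) (M : ℝ) : Decays (lap W) M := by
  intro q₀ hq₀
  obtain ⟨C, hC⟩ := decays_integral_norm hW M q₀ hq₀
  refine ⟨C, fun q hq => ?_⟩
  have := hC q hq
  rw [Complex.norm_real, Real.norm_of_nonneg (integral_nonneg fun _ => norm_nonneg _)] at this
  exact (norm_integral_le_integral_norm _).trans this

lemma isOpen_im_pos : IsOpen {z : ℂ | 0 < z.im} := isOpen_lt continuous_const Complex.continuous_im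

lemma hasFDerivAt_latSum_lap [CompleteSpace B] {W : ℝ → B} (hW : PolyGrowth W) (b c : ℕ)
    {z : ℂ} (hz : 0 < z.im) :
    HasFDerivAt (latSum b c (lap W)) (wirtingerL B (latDeriv (fun b c E => latSum b c E z) b c
      (lap W) (lap fun t => (-(Real.pi * t)) • W t) z.im)) z :=
  hasFDerivAt_latSum (N := 2 + (b + c : ℕ)) (by
      have : (0 : ℝ) ≤ (b + c : ℕ) := Nat.cast_nonneg _
      linarith)
    (fun q hq => hasDerivAt_lap hW hq) (decays_lap hW _) (decays_lap hW.mul_self _) hz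

/-- The induction runs over all `W`, `b`, `c` at once, since the derivative involves shifted degrees
and the weight `-π t W(t)`. -/
lemma contDiffOn_latSum_lap_nat [CompleteSpace B] (n : ℕ) :
    ∀ (W : ℝ → B), PolyGrowth W → ∀ b c : ℕ,
      ContDiffOn ℝ n (latSum b c (lap W)) {z : ℂ | 0 < z.im} := by
  induction n with
  | zero =>
    intro W hW b c
    refine contDiffOn_zero.2 fun z hz => ?_
    exact (hasFDerivAt_latSum_lap hW b c hz).continuousAt.continuousWithinAt
  | succ n ih =>
    intro W hW b c
    push_cast
    rw [contDiffOn_succ_iff_fderiv_of_isOpen isOpen_im_pos]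
    refine ⟨fun z hz => (hasFDerivAt_latSum_lap hW b c hz).differentiableAt.differentiableWithinAt,
      by simp, ?_⟩
    have him : ContDiffOn ℝ n (fun z : ℂ => (z.im : ℂ)) {z : ℂ | 0 < z.im} :=
      (Complex.ofRealCLM.contDiff.comp Complex.imCLM.contDiff).contDiffOn
    have hinv : ContDiffOn ℝ n (fun z : ℂ => (z.im : ℂ)⁻¹) {z : ℂ | 0 < z.im} :=
      him.inv fun z hz => by
        have : 0 < z.im := hz
        exact_mod_cast this.ne'
    have h1 : ∀ m : ℕ, ContDiffOn ℝ n (fun z : ℂ => (m : ℂ) / (2 * Complex.I * z.im))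
        {z : ℂ | 0 < z.im} := fun m => by
      refine ((contDiffOn_const (c := (m : ℂ) / (2 * Complex.I))).mul hinv).congr fun z _ => ?_
      simp only [div_eq_mul_inv, mul_inv]; ring
    have h2 : ContDiffOn ℝ n (fun z : ℂ => Complex.I / (2 * (z.im : ℂ) ^ 2))
        {z : ℂ | 0 < z.im} := by
      refine ((contDiffOn_const (c := Complex.I / 2)).mul (hinv.pow 2)).congr fun z _ => ?_
      simp only [div_eq_mul_inv, mul_inv, inv_pow]; ring
    have hA := ((h1 b).smul ((ih W hW b c).sub (ih W hW (b - 1) (c + 1)))).add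
      (h2.smul (ih _ hW.mul_self b (c + 2)))
    have hB := ((h1 c).smul ((ih W hW (b + 1) (c - 1)).sub (ih W hW b c))).sub
      (h2.smul (ih _ hW.mul_self (b + 2) c))
    refine ((wirtingerL B).contDiff.comp_contDiffOn (hA.prodMk hB)).congr fun z hz => ?_
    exact (hasFDerivAt_latSum_lap hW b c hz).fderiv

lemma contDiffOn_latSum_lap [CompleteSpace B] {W : ℝ → B} (hW : PolyGrowth W) (b c : ℕ) :
    ContDiffOn ℝ ∞ (latSum b c (lap W)) {z : ℂ | 0 < z.im} :=
  contDiffOn_infty.2 fun n => contDiffOn_latSum_lap_nat n W hW b c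

end Laplace

/-! ### Theta series with spherical polynomials and their inversion -/

section Theta

/-- The Gaussian profile `exp (-π t q)`. -/
def gauss (t q : ℝ) : ℂ := (Real.exp (-(Real.pi * t) * q) : ℂ)

lemma hasDerivAt_gauss (t q : ℝ) :
    HasDerivAt (gauss t) ((-(Real.pi * t) : ℂ) • gauss t q) q := by
  have h : HasDerivAt (fun q : ℝ => -(Real.pi * t) * q) (-(Real.pi * t) * 1) q :=
    (hasDerivAt_id q).const_mul _
  refine h.exp.ofReal_comp.congr_deriv ?_
  simp [gauss, mul_comm]

lemma decays_gauss {t : ℝ} (ht : 0 < t) (M : ℝ) : Decays (gauss t) M :=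
  decays_exp_neg (by positivity) M

lemma latSum_const_smul {B : Type*} [NormedAddCommGroup B] [NormedSpace ℂ B] (b c : ℕ) (a : ℂ)
    (E : ℝ → B) (z : ℂ) : latSum b c (fun q => a • E q) z = a • latSum b c E z := by
  simp only [latSum, latTerm, smul_comm _ a]
  exact tsum_const_smul'' a

lemma summable_gaussian {a : ℝ} (ha : 0 < a) :
    Summable fun n : ℤ => Real.exp (-(Real.pi * a) * (n : ℝ) ^ 2) := by
  have h := ((summable_jacobiTheta₂_term_iff 0 (Complex.I * a)).2 (by simpa using ha)).norm
  refine h.congr fun n => ?_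
  rw [jacobiTheta₂_term, Complex.norm_exp, mul_zero, zero_add]
  congr 1
  have : (Real.pi * Complex.I * (n : ℂ) ^ 2 * (Complex.I * a) : ℂ) =
      ((-(Real.pi * a) * (n : ℝ) ^ 2 : ℝ) : ℂ) := by
    push_cast
    linear_combination (Real.pi * (n : ℂ) ^ 2 * a : ℂ) * Complex.I_sq
  rw [this, Complex.ofReal_re]

/-- The summand obtained from the Gaussian lattice sum by Poisson summation in one variable. -/
def poissonTerm (t : ℝ) (z : ℂ) (p : ℤ × ℤ) : ℂ :=
  Complex.exp (-(Real.pi * (t * z.im)) * (p.1 : ℂ) ^ 2 - Real.pi * (z.im / t) * (p.2 : ℂ) ^ 2 +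
    2 * Real.pi * Complex.I * p.1 * p.2 * z.re)

lemma norm_poissonTerm (t : ℝ) (z : ℂ) (p : ℤ × ℤ) : ‖poissonTerm t z p‖ =
    Real.exp (-(Real.pi * (t * z.im)) * (p.1 : ℝ) ^ 2) *
      Real.exp (-(Real.pi * (z.im / t)) * (p.2 : ℝ) ^ 2) := by
  rw [poissonTerm, Complex.norm_exp, ← Real.exp_add]
  congr 1
  have : (-(Real.pi * (t * z.im)) * (p.1 : ℂ) ^ 2 - Real.pi * (z.im / t) * (p.2 : ℂ) ^ 2 +
      2 * Real.pi * Complex.I * p.1 * p.2 * z.re : ℂ) =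
      ((-(Real.pi * (t * z.im)) * (p.1 : ℝ) ^ 2 + -(Real.pi * (z.im / t)) * (p.2 : ℝ) ^ 2 : ℝ) : ℂ) +
      ((2 * Real.pi * p.1 * p.2 * z.re : ℝ) : ℂ) * Complex.I := by
    push_cast; ring
  rw [this, Complex.add_re, Complex.ofReal_re, Complex.re_ofReal_mul, Complex.I_re, mul_zero,
    add_zero]

lemma summable_poissonTerm {t : ℝ} (ht : 0 < t) {z : ℂ} (hz : 0 < z.im) :
    Summable (poissonTerm t z) := by
  refine Summable.of_norm ?_
  simp only [norm_poissonTerm]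
  exact Summable.mul_of_nonneg (summable_gaussian (by positivity))
    (summable_gaussian (by positivity)) (fun _ => (Real.exp_pos _).le)
    (fun _ => (Real.exp_pos _).le)

/-- After summation in one variable, the inversion `t ↦ 1/t` is just the exchange of the two
summation indices. -/
lemma poissonTerm_swap {t : ℝ} (z : ℂ) (p : ℤ × ℤ) :
    poissonTerm (1 / t) z p.swap = poissonTerm t z p := by
  simp only [poissonTerm, Prod.fst_swap, Prod.snd_swap]
  congr 1
  push_cast
  rw [div_div_eq_mul_div]
  ring

lemma summable_latTerm_gauss {t : ℝ} (ht : 0 < t) (b c : ℕ) {z : ℂ} (hz : 0 < z.im) :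
    Summable fun p : Pairs => latTerm b c (gauss t) z p :=
  (summable_latTerm (decays_gauss ht (2 + (b + c : ℕ))) (by
    have : (0 : ℝ) ≤ (b + c : ℕ) := Nat.cast_nonneg _
    linarith) hz).of_norm

lemma gauss_quad_eq {t : ℝ} {z : ℂ} (hz : 0 < z.im) (p : ℤ × ℤ) :
    gauss t (quad p z) = Complex.exp (-(Real.pi * t * Complex.normSq z / z.im) * (p.1 : ℂ) ^ 2) *
      Complex.exp (-Real.pi * (t / z.im : ℂ) * (p.2 : ℂ) ^ 2 +
        2 * Real.pi * (-(t * p.1 * z.re / z.im) : ℂ) * p.2) := by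
  have hy : (z.im : ℂ) ≠ 0 := by exact_mod_cast hz.ne'
  have hq : (quad p z : ℂ) =
      (Complex.normSq z * p.1 ^ 2 + 2 * p.1 * p.2 * z.re + p.2 ^ 2) / z.im := by
    have : Complex.normSq (lin p z) =
        Complex.normSq z * p.1 ^ 2 + 2 * p.1 * p.2 * z.re + p.2 ^ 2 := by
      simp [Complex.normSq_apply, lin]
      ring
    rw [quad, this]
    push_cast
    ring
  rw [gauss, Complex.ofReal_exp, ← Complex.exp_add]
  congr 1
  push_cast
  rw [hq]
  field_simp
  ring

/-- Poisson summation in `n` for fixed `m`. Completing the square turns the cross term of `q` into a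
phase depending on `Re z`. -/
lemma tsum_gauss_row {t : ℝ} (ht : 0 < t) {z : ℂ} (hz : 0 < z.im) (m : ℤ) :
    ∑' n : ℤ, gauss t (quad (m, n) z) =
      1 / (t / z.im : ℂ) ^ (1 / 2 : ℂ) * ∑' n : ℤ, poissonTerm t z (m, n) := by
  have hy : (z.im : ℂ) ≠ 0 := by exact_mod_cast hz.ne'
  have ht' : (t : ℂ) ≠ 0 := by exact_mod_cast ht.ne'
  simp only [gauss_quad_eq hz]
  rw [tsum_mul_left, Complex.tsum_exp_neg_quadratic (a := (t / z.im : ℂ))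
    (by rw [← Complex.ofReal_div, Complex.ofReal_re]; positivity), mul_left_comm, ← tsum_mul_left]
  congr 2
  ext n
  rw [← Complex.exp_add, poissonTerm]
  congr 1
  have : (Complex.normSq z : ℂ) = (z.re : ℂ) ^ 2 + (z.im : ℂ) ^ 2 := by
    rw [Complex.normSq_apply]; push_cast; ring
  rw [this]
  field_simp
  ring_nf
  simp only [Complex.I_sq]
  ring

lemma summable_gauss_quad {t : ℝ} (ht : 0 < t) {z : ℂ} (hz : 0 < z.im) :
    Summable fun p : ℤ × ℤ => gauss t (quad p z) := by
  have h := summable_latTerm_gauss ht 0 0 hz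
  simp only [latTerm, pow_zero, mul_one, one_smul] at h
  have h2 := (Finset.summable_compl_iff (f := fun p : ℤ × ℤ => gauss t (quad p z)) {(0, 0)})
  refine h2.1 ?_
  refine (Equiv.summable_iff (Equiv.subtypeEquivRight
    (p := fun p : ℤ × ℤ => p ∉ ({(0, 0)} : Finset (ℤ × ℤ)))
    (q := fun p => p ≠ (0, 0)) (by simp))).2 h

/-- The summand `1` is the contribution of `(0, 0)`, which Poisson summation needs and the lattice
sum omits. -/
lemma one_add_latSum_gauss {t : ℝ} (ht : 0 < t) {z : ℂ} (hz : 0 < z.im) :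
    1 + latSum 0 0 (gauss t) z = 1 / (t / z.im : ℂ) ^ (1 / 2 : ℂ) * ∑' p, poissonTerm t z p := by
  have hs := summable_gauss_quad ht hz
  have h1 : 1 + latSum 0 0 (gauss t) z = ∑' p : ℤ × ℤ, gauss t (quad p z) := by
    rw [hs.tsum_eq_add_tsum_ite (0, 0)]
    congr 1
    · simp [gauss, quad, lin]
    · rw [latSum]
      simp only [latTerm, pow_zero, mul_one, one_smul]
      rw [show (∑' p : Pairs, gauss t (quad (p : ℤ × ℤ) z)) = _ from
        tsum_subtype {p : ℤ × ℤ | p ≠ (0, 0)} (fun p => gauss t (quad p z))]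
      refine tsum_congr fun p => ?_
      by_cases hp : p = (0, 0) <;> simp [Set.indicator, hp]
  rw [h1, hs.tsum_prod, (summable_poissonTerm ht hz).tsum_prod, ← tsum_mul_left]
  exact tsum_congr fun m => tsum_gauss_row ht hz m

lemma theta_zero_inv {t : ℝ} (ht : 0 < t) {z : ℂ} (hz : 0 < z.im) :
    1 + latSum 0 0 (gauss (1 / t)) z = t * (1 + latSum 0 0 (gauss t) z) := by
  rw [one_add_latSum_gauss ht hz, one_add_latSum_gauss (one_div_pos.2 ht) hz,
    ← (Equiv.prodComm ℤ ℤ).tsum_eq (poissonTerm (1 / t) z), ← mul_assoc]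
  congr 1
  · have h1 : ((1 / t : ℝ) / z.im : ℂ) ^ (1 / 2 : ℂ) = ((√(1 / t / z.im) : ℝ) : ℂ) := by
      rw [Real.sqrt_eq_rpow, Complex.ofReal_cpow (by positivity)]; push_cast; rfl
    have h2 : (t / z.im : ℂ) ^ (1 / 2 : ℂ) = ((√(t / z.im) : ℝ) : ℂ) := by
      rw [Real.sqrt_eq_rpow, Complex.ofReal_cpow (by positivity)]; push_cast; rfl
    rw [h1, h2]
    have h3 : √(t / z.im) = t * √(1 / t / z.im) := by
      rw [show t / z.im = t ^ 2 * (1 / t / z.im) by field_simp, Real.sqrt_mul (by positivity),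
        Real.sqrt_sq ht.le]
    have h4 : ((√(1 / t / z.im) : ℝ) : ℂ) ≠ 0 := by
      exact_mod_cast (Real.sqrt_pos.2 (by positivity)).ne'
    have h5 : (t : ℂ) ≠ 0 := by exact_mod_cast ht.ne'
    rw [h3]
    push_cast
    field_simp
  · exact tsum_congr fun p => poissonTerm_swap z p

/-- Since `u` is holomorphic in `z`, only the Gaussian is differentiated, and `∂q/∂z̄` is a multiple
of `u²`. -/
lemma dbarC_latSum_gauss {t : ℝ} (ht : 0 < t) (a : ℕ) {z : ℂ} (hz : 0 < z.im) :
    dbarC (latSum a 0 (gauss t)) z =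
      (Complex.I / (2 * (z.im : ℂ) ^ 2)) * (Real.pi * t) * latSum (a + 2) 0 (gauss t) z := by
  rw [dbarC_latSum (N := 2 + (a + 0 : ℕ)) (by
    have : (0 : ℝ) ≤ (a + 0 : ℕ) := Nat.cast_nonneg _
    linarith) (fun q _ => hasDerivAt_gauss t q) (decays_gauss ht _)
    ((decays_gauss ht _).const_smul _) hz, latSum_const_smul]
  simp only [Nat.cast_zero, zero_div, smul_eq_mul]
  ring

lemma differentiableAt_latSum_gauss {t : ℝ} (ht : 0 < t) (b c : ℕ) {z : ℂ} (hz : 0 < z.im) :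
    DifferentiableAt ℝ (latSum b c (gauss t)) z :=
  (hasFDerivAt_latSum (N := 2 + (b + c : ℕ)) (by
    have : (0 : ℝ) ≤ (b + c : ℕ) := Nat.cast_nonneg _
    linarith) (fun q _ => hasDerivAt_gauss t q) (decays_gauss ht _)
    ((decays_gauss ht _).const_smul _) hz).differentiableAt

/-- Applying `∂/∂z̄` to the law in degree `2 j` brings out a factor `1/t` on the left and `t` on the
right. This gives the law in degree `2 j + 2`, with two more powers of `t`. -/
lemma theta_inv_holo {t : ℝ} (ht : 0 < t) (j : ℕ) :
    ∀ {z : ℂ}, 0 < z.im → 0 ^ (2 * j) + latSum (2 * j) 0 (gauss (1 / t)) z =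
      (t : ℂ) ^ (2 * j + 1) * (0 ^ (2 * j) + latSum (2 * j) 0 (gauss t) z) := by
  induction j with
  | zero => intro z hz; simpa using theta_zero_inv ht hz
  | succ j ih =>
    intro z hz
    have ht1 : 0 < 1 / t := one_div_pos.2 ht
    have hy : (z.im : ℂ) ≠ 0 := by exact_mod_cast hz.ne'
    have ht' : (t : ℂ) ≠ 0 := by exact_mod_cast ht.ne'
    have hev : (fun w => 0 ^ (2 * j) + latSum (2 * j) 0 (gauss (1 / t)) w) =ᶠ[𝓝 z]
        fun w => (t : ℂ) ^ (2 * j + 1) • (0 ^ (2 * j) + latSum (2 * j) 0 (gauss t) w) :=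
      (isOpen_im_pos.eventually_mem hz).mono fun w hw => ih hw
    have h := dbarC_congr hev
    rw [dbarC_const_smul (f := fun w => 0 ^ (2 * j) + latSum (2 * j) 0 (gauss t) w)
        ((differentiableAt_const _).add (differentiableAt_latSum_gauss ht _ _ hz)),
      dbarC_add (differentiableAt_const _) (differentiableAt_latSum_gauss ht1 _ _ hz),
      dbarC_add (differentiableAt_const _) (differentiableAt_latSum_gauss ht _ _ hz),
      dbarC_const, zero_add, zero_add, dbarC_latSum_gauss ht _ hz, dbarC_latSum_gauss ht1 _ hz,
      smul_eq_mul] at h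
    have hpi : (Real.pi : ℂ) ≠ 0 := by exact_mod_cast Real.pi_ne_zero
    push_cast at h
    rw [show 2 * (j + 1) = 2 * j + 2 by ring, zero_pow (by omega), zero_add, zero_add]
    have hI := Complex.I_ne_zero
    field_simp at h
    rw [h]
    ring

lemma latSum_conj {E : ℝ → ℂ} (b c : ℕ) (z : ℂ) :
    conj (latSum b c E z) = latSum c b (fun q => conj (E q)) z := by
  rw [latSum, latSum, Complex.conj_tsum]
  refine tsum_congr fun p => ?_
  simp only [latTerm, smul_eq_mul, map_mul, map_pow, Complex.conj_conj]
  ring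

lemma conj_gauss (t q : ℝ) : conj (gauss t q) = gauss t q := Complex.conj_ofReal _

/-- The transformation law of theta series with a spherical polynomial of even degree. -/
lemma theta_inv {t : ℝ} (ht : 0 < t) {b c : ℕ} (hbc : b = 0 ∨ c = 0) (hev : Even (b + c))
    {z : ℂ} (hz : 0 < z.im) :
    0 ^ (b + c) + latSum b c (gauss (1 / t)) z =
      (t : ℂ) ^ (b + c + 1) * (0 ^ (b + c) + latSum b c (gauss t) z) := by
  obtain ⟨j, hj⟩ := hev
  rw [← two_mul] at hj
  rcases hbc with rfl | rfl
  · rw [zero_add] at hj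
    subst hj
    have h := congrArg conj (theta_inv_holo ht j hz)
    simp only [map_add, map_mul, map_pow, map_zero, Complex.conj_ofReal, latSum_conj,
      conj_gauss] at h
    simpa using h
  · rw [add_zero] at hj
    subst hj
    exact theta_inv_holo ht j hz

lemma Decays.mul_id {B : Type*} [NormedAddCommGroup B] [NormedSpace ℂ B] {E : ℝ → B} {N : ℝ}
    (h : Decays E (N + 1)) : Decays (fun q => (q : ℂ) • E q) N := fun q₀ hq₀ => by
  obtain ⟨C, hC⟩ := h q₀ hq₀
  refine ⟨C, fun q hq => ?_⟩
  have hq0 : 0 < q := by linarith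
  rw [norm_smul, Complex.norm_real, Real.norm_of_nonneg hq0.le]
  calc q * ‖E q‖ ≤ q * (C * q ^ (-(N + 1))) := by gcongr; exact hC q hq
    _ = C * q ^ (-N) := by
      rw [show -N = 1 + -(N + 1) by ring, Real.rpow_add hq0, Real.rpow_one]; ring

/-- On `(t/2, ∞)` the differentiated terms are dominated by their values at `t/2`. -/
lemma hasDerivAt_latSum_gauss (b c : ℕ) {z : ℂ} (hz : 0 < z.im) {t : ℝ} (ht : 0 < t) :
    HasDerivAt (fun t => latSum b c (gauss t) z)
      (-Real.pi * latSum b c (fun q => (q : ℂ) • gauss t q) z) t := by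
  have hN : (2 : ℝ) + (b + c : ℕ) < 2 * (2 + (b + c : ℕ)) := by
    have : (0 : ℝ) ≤ (b + c : ℕ) := Nat.cast_nonneg _
    linarith
  have hs := summable_latTerm (b := b) (c := c) ((decays_gauss (half_pos ht) _).mul_id) hN hz
  have hpi := Real.pi_pos
  have main := hasDerivAt_tsum_of_isPreconnected (𝕜 := ℝ) (t := Ioi (t / 2)) (y₀ := t) (y := t)
    (g := fun (p : Pairs) t => latTerm b c (gauss t) z p)
    (g' := fun (p : Pairs) t => -Real.pi * latTerm b c (fun q => (q : ℂ) • gauss t q) z p)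
    (hs.mul_left Real.pi) isOpen_Ioi isPreconnected_Ioi
    (fun p y _ => by
      have h : HasDerivAt (fun t : ℝ => -(Real.pi * t) * quad p z) (-(Real.pi * 1) * quad p z) y :=
        (((hasDerivAt_id y).const_mul Real.pi).neg).mul_const _
      refine ((h.exp.ofReal_comp).const_mul (lin p z ^ b * conj (lin p z) ^ c)).congr_deriv ?_
      simp only [latTerm, gauss, smul_eq_mul]
      push_cast
      ring)
    (fun p y hy => by
      have hy : t / 2 < y := hy
      have hq := quad_pos p hz
      rw [norm_mul, norm_neg, Complex.norm_real, Real.norm_of_nonneg hpi.le]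
      simp only [latTerm, gauss, norm_smul, Complex.norm_real,
        Real.norm_of_nonneg (Real.exp_pos _).le]
      gcongr)
    (show t / 2 < t by linarith) (summable_latTerm_gauss ht b c hz) (show t / 2 < t by linarith)
  rw [tsum_mul_left] at main
  exact main

/-- The derivative at `t = 1` of the transformation law of theta series. -/
lemma theta_inv_deriv {b c : ℕ} (hbc : b = 0 ∨ c = 0) (hev : Even (b + c))
    {z : ℂ} (hz : 0 < z.im) :
    2 * Real.pi * latSum b c (fun q => (q : ℂ) • gauss 1 q) z =
      ((b + c : ℕ) + 1 : ℂ) * (0 ^ (b + c) + latSum b c (gauss 1) z) := by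
  have h1 := (hasDerivAt_latSum_gauss b c hz one_pos).const_add (0 ^ (b + c))
  have h2 : HasDerivAt (fun t : ℝ => 0 ^ (b + c) + latSum b c (gauss (1 / t)) z)
      (-(-Real.pi * latSum b c (fun q => (q : ℂ) • gauss 1 q) z)) 1 := by
    have hi : HasDerivAt (fun t : ℝ => 1 / t) (-1) 1 := by
      simpa using hasDerivAt_inv (one_ne_zero (α := ℝ))
    have h1' : HasDerivAt (fun t : ℝ => 0 ^ (b + c) + latSum b c (gauss t) z)
      (-Real.pi * latSum b c (fun q => (q : ℂ) • gauss 1 q) z) (1 / 1) := by simpa using h1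
    exact (h1'.scomp 1 hi).congr_deriv (by simp)
  have h3 : HasDerivAt (fun t : ℝ => (t : ℂ) ^ (b + c + 1)) ((b + c : ℕ) + 1 : ℂ) 1 := by
    exact (((hasDerivAt_id (1 : ℝ)).ofReal_comp).pow (b + c + 1)).congr_deriv (by simp)
  have h4 := h3.mul h1
  have h5 : (fun t : ℝ => 0 ^ (b + c) + latSum b c (gauss (1 / t)) z) =ᶠ[𝓝 1]
      fun t : ℝ => (t : ℂ) ^ (b + c + 1) * (0 ^ (b + c) + latSum b c (gauss t) z) :=
    (lt_mem_nhds (one_pos (α := ℝ))).mono fun t ht => theta_inv ht hbc hev hz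
  -- For `Θ(1/t) = t ^ (b + c + 1) Θ(t)` the derivatives at `t = 1` give `-Θ' = (b + c + 1) Θ + Θ'`.
  have h6 := (h2.congr_of_eventuallyEq h5.symm).unique h4
  simp only [Complex.ofReal_one, one_pow, one_mul] at h6
  linear_combination h6

end Theta

/-! ### Mellin transforms of theta series -/

section FunctionalEquation

lemma PolyGrowth.add {B : Type*} [NormedAddCommGroup B] [NormedSpace ℂ B] {V W : ℝ → B}
    (hV : PolyGrowth V) (hW : PolyGrowth W) : PolyGrowth fun t => V t + W t where
  cont := hV.cont.add hW.cont
  bound := by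
    obtain ⟨C, n, hC0, hC⟩ := hV.bound
    obtain ⟨D, m, hD0, hD⟩ := hW.bound
    refine ⟨C + D, n + m, by positivity, fun t ht => ?_⟩
    have h1 : t ^ n ≤ t ^ (n + m) := pow_le_pow_right₀ (le_of_lt ht) (by omega)
    have h2 : t ^ m ≤ t ^ (n + m) := pow_le_pow_right₀ (le_of_lt ht) (by omega)
    calc _ ≤ C * t ^ n + D * t ^ m := (norm_add_le _ _).trans (add_le_add (hC t ht) (hD t ht))
      _ ≤ C * t ^ (n + m) + D * t ^ (n + m) := by gcongr
      _ = _ := by ring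

lemma polyGrowth_cpow (s : ℂ) : PolyGrowth fun t : ℝ => (t : ℂ) ^ s where
  cont := fun t ht => by
    have : (t : ℂ) ∈ Complex.slitPlane := by
      rw [Complex.ofReal_mem_slitPlane]; exact one_pos.trans ht
    exact (by fun_prop (disch := assumption) :
      ContinuousAt (fun t : ℝ => (t : ℂ) ^ s) t).continuousWithinAt
  bound := by
    refine ⟨1, ⌈s.re⌉₊, zero_le_one, fun t ht => ?_⟩
    rw [Complex.norm_cpow_eq_rpow_re_of_pos (one_pos.trans ht), one_mul, ← Real.rpow_natCast]
    exact Real.rpow_le_rpow_of_exponent_le (le_of_lt ht) (Nat.le_ceil _)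

lemma integral_mul_latSum_gauss {W : ℝ → ℂ} (hW : PolyGrowth W) (b c : ℕ) {z : ℂ}
    (hz : 0 < z.im) :
    ∫ t in Ioi (1 : ℝ), W t * latSum b c (gauss t) z = latSum b c (lap W) z := by
  have hN : (2 : ℝ) + (b + c : ℕ) < 2 * (2 + (b + c : ℕ)) := by
    have : (0 : ℝ) ≤ (b + c : ℕ) := Nat.cast_nonneg _
    linarith
  have hs := summable_latTerm (b := b) (c := c) (decays_integral_norm hW _) hN hz
  have key := hasSum_integral_of_summable_integral_norm (μ := volume.restrict (Ioi (1 : ℝ)))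
    (F := fun (p : Pairs) t => (lin p z ^ b * conj (lin p z) ^ c) *
      Real.exp (-(Real.pi * quad p z) * t) • W t)
    (fun p => (hW.integrableOn (mul_pos Real.pi_pos (quad_pos p hz))).const_mul _) (by
      refine hs.congr fun p => ?_
      simp only [norm_mul, integral_const_mul, latTerm, norm_smul]
      rw [Complex.norm_real, Real.norm_of_nonneg
        (integral_nonneg fun t => mul_nonneg (norm_nonneg _) (norm_nonneg _))])
  simp only [integral_const_mul] at key
  rw [latSum, show (∑' p : Pairs, latTerm b c (lap W) z p) = _ from key.tsum_eq]
  refine setIntegral_congr_fun measurableSet_Ioi fun t _ => ?_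
  simp only [latSum]
  rw [← tsum_mul_left]
  refine tsum_congr fun p => ?_
  simp only [latTerm, gauss, Complex.real_smul, smul_eq_mul]
  rw [show -(Real.pi * t) * quad p z = -(Real.pi * quad p z) * t by ring]
  ring

lemma exists_quad_lower_bound {z : ℂ} (hz : 0 < z.im) : ∃ q₀ > 0, ∀ p : Pairs, q₀ ≤ quad p z := by
  set K := 1 / z.im + 1 + ‖z‖ / z.im
  have hK : 0 < K := by positivity
  refine ⟨(K ^ 2 * z.im)⁻¹, by positivity, fun p => ?_⟩
  have h : 1 ≤ K * ‖lin p z‖ := (one_le_norm_pairs p).trans (norm_le_lin p hz)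
  rw [quad, Complex.normSq_eq_norm_sq]
  calc (K ^ 2 * z.im)⁻¹ = (K ^ 2 * z.im)⁻¹ * 1 ^ 2 := by ring
    _ ≤ (K ^ 2 * z.im)⁻¹ * (K * ‖lin p z‖) ^ 2 := by gcongr
    _ = _ := by field_simp

lemma isBigO_latSum_gauss (b c : ℕ) {z : ℂ} (hz : 0 < z.im) (r : ℝ) :
    (fun t => latSum b c (gauss t) z) =O[atTop] fun t : ℝ => t ^ r := by
  obtain ⟨q₀, hq₀, hq⟩ := exists_quad_lower_bound hz
  have hpi := Real.pi_pos
  have hs := (summable_latTerm_gauss (t := 1 / 2) (by norm_num) b c hz).norm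
  refine Asymptotics.IsBigO.trans ?_
    (isLittleO_exp_neg_mul_rpow_atTop (a := Real.pi * q₀ / 2) (by positivity) r).isBigO
  refine Asymptotics.IsBigO.of_bound (∑' p : Pairs, ‖latTerm b c (gauss (1 / 2)) z p‖) ?_
  filter_upwards [eventually_ge_atTop 1] with t ht
  rw [Real.norm_of_nonneg (Real.exp_pos _).le, ← tsum_mul_right]
  refine tsum_of_norm_bounded (hs.mul_right _).hasSum fun p => ?_
  simp only [latTerm, norm_smul, gauss, Complex.norm_real, Real.norm_of_nonneg (Real.exp_pos _).le]
  rw [mul_assoc, ← Real.exp_add]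
  gcongr
  have h1 : q₀ * t ≤ quad p z * t := by gcongr; exact hq p
  have h2 : quad p z * 1 ≤ quad p z * t := by gcongr; exact (quad_pos p hz).le
  nlinarith

lemma continuousOn_latSum_gauss (b c : ℕ) {z : ℂ} (hz : 0 < z.im) :
    ContinuousOn (fun t => latSum b c (gauss t) z) (Ioi 0) := fun _ ht =>
  (hasDerivAt_latSum_gauss b c hz ht).continuousAt.continuousWithinAt

/-- The pair of theta series whose Mellin transform gives the completed Eisenstein series. -/
def thetaPair (b c : ℕ) (hbc : b = 0 ∨ c = 0) (hev : Even (b + c)) {z : ℂ} (hz : 0 < z.im) :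
    WeakFEPair ℂ where
  f t := 0 ^ (b + c) + latSum b c (gauss t) z
  g t := 0 ^ (b + c) + latSum b c (gauss t) z
  k := (b + c : ℕ) + 1
  ε := 1
  f₀ := 0 ^ (b + c)
  g₀ := 0 ^ (b + c)
  hf_int := (continuousOn_const.add (continuousOn_latSum_gauss b c hz)).locallyIntegrableOn
    measurableSet_Ioi
  hg_int := (continuousOn_const.add (continuousOn_latSum_gauss b c hz)).locallyIntegrableOn
    measurableSet_Ioi
  hk := by positivity
  hε := one_ne_zero
  h_feq := fun t ht => by
    rw [theta_inv ht hbc hev hz, one_mul, smul_eq_mul]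
    congr 1
    rw [← Nat.cast_add_one, Real.rpow_natCast, Complex.ofReal_pow]
  hf_top := fun r => by simpa using isBigO_latSum_gauss b c hz r
  hg_top := fun r => by simpa using isBigO_latSum_gauss b c hz r

/-- The kernel `t ^ (s - 1) + t ^ (a - s)`, symmetric under `s ↦ a + 1 - s`. -/
def mellinKernel (a : ℕ) (s : ℂ) (t : ℝ) : ℂ := (t : ℂ) ^ (s - 1) + (t : ℂ) ^ ((a : ℂ) - s)

lemma polyGrowth_mellinKernel (a : ℕ) (s : ℂ) : PolyGrowth (mellinKernel a s) :=
  (polyGrowth_cpow _).add (polyGrowth_cpow _)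

/-- The entire part of the Mellin transform of a theta series. -/
def entirePart (b c : ℕ) (z s : ℂ) : ℂ := latSum b c (lap (mellinKernel (b + c) s)) z

/-- The reflection exchanges the two powers of `t` in the kernel. -/
lemma entirePart_symm (b c : ℕ) (z s : ℂ) :
    entirePart b c z ((b + c : ℕ) + 1 - s) = entirePart b c z s := by
  have : mellinKernel (b + c) ((b + c : ℕ) + 1 - s) = mellinKernel (b + c) s := by
    ext t
    simp only [mellinKernel]
    rw [add_comm]
    congr 2 <;> ring
  rw [entirePart, this, entirePart]

/-- Fold the Mellin integral at `t = 1`: the substitution `t ↦ 1/t` on `(0, 1)`, combined with the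
functional equation, contributes the second power `t ^ (b + c - s)` of the kernel. -/
lemma thetaPair_Λ₀ {b c : ℕ} (hbc : b = 0 ∨ c = 0) (hev : Even (b + c)) {z : ℂ} (hz : 0 < z.im)
    (s : ℂ) : (thetaPair b c hbc hev hz).Λ₀ s = entirePart b c z s := by
  set P := thetaPair b c hbc hev hz with hP
  set A : ℝ → ℂ := (Ioi 1).indicator fun t => latSum b c (gauss t) z with hA
  have hconv : ∀ s, MellinConvergent P.f_modif s := fun s =>
    (P.isStrongFEPair_toStrongFEPair.hasMellin s).1
  have hAf : A = (Ioi 1).indicator P.f_modif := by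
    ext t
    by_cases ht : t ∈ Ioi (1 : ℝ)
    · have h2 : t ∉ Ioo (0 : ℝ) 1 := fun h => lt_asymm h.2 ht
      simp only [hA, WeakFEPair.f_modif, Pi.add_apply, indicator_of_mem ht,
        indicator_of_notMem h2, add_zero]
      simp [hP, thetaPair]
    · simp only [hA, indicator_of_notMem ht]
  have hAconv : ∀ s, MellinConvergent A s := fun s => by
    have := (hconv s).indicator (measurableSet_Ioi (a := (1 : ℝ)))
    rw [MellinConvergent, hAf]
    simpa only [indicator_smul] using this
  have hAmellin : ∀ s, mellin A s = latSum b c (lap fun t => (t : ℂ) ^ (s - 1)) z := fun s => by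
    rw [← integral_mul_latSum_gauss (polyGrowth_cpow _) b c hz, mellin]
    rw [show (fun t : ℝ => (t : ℂ) ^ (s - 1) • A t) =
      (Ioi 1).indicator fun t : ℝ => (t : ℂ) ^ (s - 1) • latSum b c (gauss t) z from
      (indicator_smul _ _ _).symm, setIntegral_indicator measurableSet_Ioi,
      inter_eq_right.2 (Ioi_subset_Ioi zero_le_one)]
    rfl
  have hint : ∀ s : ℂ, IntegrableOn (fun t : ℝ => (t : ℂ) ^ (s - 1) * latSum b c (gauss t) z)
      (Ioi 1) := fun s => by
    refine IntegrableOn.congr_fun ((hAconv s).mono_set (Ioi_subset_Ioi (zero_le_one (α := ℝ))))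
      (fun t ht => ?_) measurableSet_Ioi
    simp only [hA, indicator_of_mem ht, smul_eq_mul]
  have hkc : (P.k : ℂ) = (b + c : ℕ) + 1 := by simp [hP, thetaPair]
  -- On `(0, 1)` the modified function is the image under inversion of its part `A` on `(1, ∞)`; at
  -- `t = 1` all terms vanish.
  have hsplit : ∀ t ∈ Ioi (0 : ℝ), P.f_modif t = A t + (t : ℂ) ^ (-(P.k : ℂ)) • A t⁻¹ := by
    intro t ht
    have ht : 0 < t := ht
    rcases lt_trichotomy t 1 with h | h | h
    · have h1 : t ∉ Ioi (1 : ℝ) := fun h' => lt_asymm h h'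
      have h2 : t ∈ Ioo (0 : ℝ) 1 := ⟨ht, h⟩
      have h3 : t⁻¹ ∈ Ioi (1 : ℝ) := (one_lt_inv₀ ht).2 h
      have hfe := P.h_feq t⁻¹ (inv_pos.2 ht)
      rw [one_div, inv_inv] at hfe
      simp only [hA, WeakFEPair.f_modif, Pi.add_apply, indicator_of_mem h2,
        indicator_of_notMem h1, indicator_of_mem h3, zero_add, hfe]
      have h4 : ((t⁻¹ ^ P.k : ℝ) : ℂ) = (t : ℂ) ^ (-(P.k : ℂ)) := by
        rw [Real.inv_rpow ht.le, ← Real.rpow_neg ht.le, Complex.ofReal_cpow ht.le]; push_cast; rfl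
      have h5 : ((t ^ (-P.k) : ℝ) : ℂ) = (t : ℂ) ^ (-(P.k : ℂ)) := by
        rw [Complex.ofReal_cpow ht.le]; push_cast; rfl
      rw [h4, h5]
      simp [hP, thetaPair]
      ring
    · subst h
      simp [hA, WeakFEPair.f_modif]
    · have h1 : t ∉ Ioo (0 : ℝ) 1 := fun h' => lt_asymm h h'.2
      have h3 : t⁻¹ ∉ Ioi (1 : ℝ) := fun h' => lt_asymm ((one_lt_inv₀ ht).1 h') h
      simp only [hA, WeakFEPair.f_modif, Pi.add_apply, indicator_of_mem (mem_Ioi.2 h),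
        indicator_of_notMem h1, indicator_of_notMem h3, smul_zero, add_zero]
      simp [hP, thetaPair]
  have h1 : mellin P.f_modif s =
      mellin (fun t => A t + (t : ℂ) ^ (-(P.k : ℂ)) • A t⁻¹) s :=
    setIntegral_congr_fun measurableSet_Ioi fun t ht => by simp only [hsplit t ht]
  have hBconv : MellinConvergent (fun t => (t : ℂ) ^ (-(P.k : ℂ)) • A t⁻¹) s := by
    rw [MellinConvergent.cpow_smul]
    simp_rw [← Real.rpow_neg_one]
    rw [MellinConvergent.comp_rpow (by norm_num)]
    exact hAconv _
  rw [WeakFEPair.Λ₀, h1, (hasMellin_add (hAconv s) hBconv).2, mellin_cpow_smul, mellin_comp_inv,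
    hAmellin, hAmellin, ← integral_mul_latSum_gauss (polyGrowth_cpow _) b c hz,
    ← integral_mul_latSum_gauss (polyGrowth_cpow _) b c hz, entirePart,
    ← integral_mul_latSum_gauss (polyGrowth_mellinKernel _ _) b c hz, ← integral_add]
  · refine setIntegral_congr_fun measurableSet_Ioi fun t _ => ?_
    simp only [mellinKernel, hkc]
    rw [← add_mul]
    congr 3
    ring
  · exact hint _
  · exact hint _

lemma differentiable_entirePart {b c : ℕ} (hbc : b = 0 ∨ c = 0) (hev : Even (b + c)) {z : ℂ}
    (hz : 0 < z.im) : Differentiable ℂ (entirePart b c z) := by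
  have h := (thetaPair b c hbc hev hz).differentiable_Λ₀
  rwa [show (thetaPair b c hbc hev hz).Λ₀ = entirePart b c z from
    funext (thetaPair_Λ₀ hbc hev hz)] at h

/-- The Dirichlet series of a theta series with a spherical polynomial. -/
lemma hasSum_entirePart {b c : ℕ} (hbc : b = 0 ∨ c = 0) (hev : Even (b + c)) {z : ℂ}
    (hz : 0 < z.im) {s : ℂ} (hs : 1 + ((b + c : ℕ) : ℝ) / 2 < s.re) :
    HasSum (fun p : Pairs => (Real.pi : ℂ) ^ (-s) * Complex.Gamma s *
        (lin p z ^ b * conj (lin p z) ^ c) / (quad p z : ℂ) ^ s)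
      (entirePart b c z s - 0 ^ (b + c) / s - 0 ^ (b + c) / ((b + c : ℕ) + 1 - s)) := by
  set P := thetaPair b c hbc hev hz with hP
  have hab : (0 : ℝ) ≤ (b + c : ℕ) := Nat.cast_nonneg _
  have hdec : Decays (fun q : ℝ => ((q ^ (-s.re) : ℝ) : ℂ)) s.re := fun q₀ hq₀ =>
    ⟨1, fun q hq => by
      have : 0 < q := by linarith
      rw [Complex.norm_real, Real.norm_of_nonneg (by positivity), one_mul]⟩
  have hsum := summable_latTerm (b := b) (c := c) hdec (by linarith) hz
  have h1 := hasSum_mellin_pi_mul (a := fun p : Pairs => lin p z ^ b * conj (lin p z) ^ c)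
    (q := fun p => quad p z) (F := fun t => latSum b c (gauss t) z) (s := s)
    (fun p => Or.inr (quad_pos p hz)) (by linarith)
    (fun t ht => by
      convert (summable_latTerm_gauss ht b c hz).hasSum using 2 with p
      · rw [latTerm, gauss, smul_eq_mul,
          show -(Real.pi * t) * quad p z = -Real.pi * quad p z * t by ring]
      · rfl)
    (by
      refine hsum.congr fun p => ?_
      have := quad_pos p hz
      rw [latTerm, norm_smul, Complex.norm_real, Real.norm_of_nonneg (by positivity),
        Real.rpow_neg this.le, div_eq_mul_inv])
  have h2 : mellin (fun t => latSum b c (gauss t) z) s = P.Λ s := by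
    have hf : (fun t => latSum b c (gauss t) z) = (P.f · - P.f₀) := by
      ext t; simp [hP, thetaPair]
    -- In degree `0` the constant term must be removed and the Mellin integral converges only for
    -- `Re s > 1`. In positive degree there is no constant term, so it converges for every `s`.
    rcases Nat.eq_zero_or_pos (b + c) with h0 | h0
    · rw [hf]
      refine (P.hasMellin ?_).2
      simp only [hP, thetaPair]
      rw [h0] at hs ⊢
      simpa using hs
    · have hst : IsStrongFEPair P :=
        ⟨by simp [hP, thetaPair]; omega, by simp [hP, thetaPair]; omega⟩
      rw [hf, hst.hf₀]
      simp only [sub_zero]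
      exact (hst.hasMellin s).2
  rw [h2] at h1
  convert h1 using 1
  rw [WeakFEPair.Λ, thetaPair_Λ₀]
  simp [hP, thetaPair, div_eq_mul_inv, mul_comm]

end FunctionalEquation

/-! ### Analytic continuation of the Eisenstein series -/

section Continuation

/-- The doubly completed Eisenstein series of weight `-a` as an entire function. -/
def eisNonpos (a : ℕ) (z s : ℂ) : ℂ :=
  (s - a / 2) * (s - a / 2 - 1) * (1 / 2 * (Real.pi : ℂ) ^ ((a : ℂ) / 2) * entirePart a 0 z s) +
    1 / 2 * 0 ^ a

/-- The doubly completed Eisenstein series of weight `k > 0` as an entire function. -/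
def eisPos (k : ℕ) (z s : ℂ) : ℂ :=
  (s + k / 2) * (s + k / 2 - 1) * (1 / 2 * (Real.pi : ℂ) ^ ((k : ℂ) / 2) *
    (((z.im : ℂ) ^ k)⁻¹ * entirePart 0 k z (s + k)))

lemma differentiable_eisNonpos {a : ℕ} (ha : Even a) {z : ℂ} (hz : 0 < z.im) :
    Differentiable ℂ (eisNonpos a z) := by
  have h := differentiable_entirePart (b := a) (c := 0) (Or.inr rfl) (by simpa using ha) hz
  unfold eisNonpos
  fun_prop

lemma differentiable_eisPos {k : ℕ} (hk : Even k) {z : ℂ} (hz : 0 < z.im) :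
    Differentiable ℂ (eisPos k z) := by
  have h := differentiable_entirePart (b := 0) (c := k) (Or.inl rfl) (by simpa using hk) hz
  have h2 : Differentiable ℂ fun s : ℂ => entirePart 0 k z (s + k) :=
    h.comp (by fun_prop : Differentiable ℂ fun s : ℂ => s + k)
  unfold eisPos
  fun_prop

/-- The quadratic prefactor is invariant too: `s + k/2` and `s + k/2 - 1` are exchanged up to sign.
-/
lemma eisPos_symm (k : ℕ) (z s : ℂ) : eisPos k z (1 - k - s) = eisPos k z s := by
  have h := entirePart_symm 0 k z (s + k)
  simp only [zero_add] at h
  rw [eisPos, show (1 - k - s + k : ℂ) = k + 1 - (s + k) by ring, h, eisPos]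
  ring

lemma quad_cpow (p : Pairs) {z : ℂ} (hz : 0 < z.im) (s : ℂ) :
    (quad p z : ℂ) ^ s = ((‖lin p z‖ : ℝ) : ℂ) ^ (2 * s) / (z.im : ℂ) ^ s := by
  have hu : ((‖lin p z‖ : ℝ) : ℂ) ≠ 0 := by exact_mod_cast norm_ne_zero_iff.2 (lin_ne_zero p hz)
  have hy : (z.im : ℂ) ≠ 0 := by exact_mod_cast hz.ne'
  have h : ((‖lin p z‖ : ℝ) : ℂ) ^ (2 * s) = (quad p z : ℂ) ^ s * (z.im : ℂ) ^ s := by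
    rw [← Complex.mul_cpow_ofReal_nonneg (quad_pos p hz).le hz.le, quad]
    have : ((Complex.normSq (lin p z) / z.im : ℝ) : ℂ) * z.im =
        ((‖lin p z‖ : ℝ) : ℂ) * ((‖lin p z‖ : ℝ) : ℂ) := by
      rw [Complex.normSq_eq_norm_sq]; push_cast; field_simp
    rw [this, Complex.mul_cpow_ofReal_nonneg (norm_nonneg _) (norm_nonneg _), two_mul,
      Complex.cpow_add _ _ hu]
  have hys : (z.im : ℂ) ^ s ≠ 0 := by simp [Complex.cpow_eq_zero_iff, hy]
  rw [h]
  field_simp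

lemma eisNonpos_eq_series {a : ℕ} (ha : Even a) (z : ℍ) {s : ℂ} (hs : 1 + (a : ℝ) / 2 < s.re) :
    eisNonpos a z s = doublyCompletedSeries (-(a : ℤ)) z s := by
  have hz : 0 < (z : ℂ).im := z.im_pos
  have hpi : (Real.pi : ℂ) ≠ 0 := by exact_mod_cast Real.pi_ne_zero
  have hsum := (hasSum_entirePart (b := a) (c := 0) (Or.inr rfl) (by simpa using ha) hz
    (s := s) (by simpa using hs)).mul_left (1 / 2 * (Real.pi : ℂ) ^ ((a : ℂ) / 2))
  have hL : completedSeries (-(a : ℤ)) z s = 1 / 2 * (Real.pi : ℂ) ^ ((a : ℂ) / 2) *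
      (entirePart a 0 z s - 0 ^ (a + 0) / s - 0 ^ (a + 0) / ((a + 0 : ℕ) + 1 - s)) := by
    rw [← hsum.tsum_eq, completedSeries, eisSeries, ← mul_assoc, ← tsum_mul_left]
    refine tsum_congr fun p => ?_
    have hG : s + ((-(a : ℤ) : ℤ) : ℂ) / 2 + ((|-(a : ℤ)| : ℤ) : ℂ) / 2 = s := by
      rw [abs_neg, Nat.abs_cast]; push_cast; ring
    have hP : (Real.pi : ℂ) ^ (-(s + ((-(a : ℤ) : ℤ) : ℂ) / 2)) =
        (Real.pi : ℂ) ^ ((a : ℂ) / 2) * (Real.pi : ℂ) ^ (-s) := by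
      rw [← Complex.cpow_add _ _ hpi]; congr 1; push_cast; ring
    have hu : ((p : ℤ × ℤ).1 : ℂ) * z + ((p : ℤ × ℤ).2 : ℂ) = lin p z := rfl
    have hy : z.im = (z : ℂ).im := rfl
    rw [hG, hP, quad_cpow p hz, hu, hy, zpow_neg, zpow_natCast, pow_zero, mul_one,
      div_div_eq_mul_div, div_mul_eq_div_div, div_inv_eq_mul]
    ring
  rw [doublyCompletedSeries, hL, eisNonpos]
  have hre : 1 < s.re := by
    have : (0 : ℝ) ≤ a := a.cast_nonneg
    linarith
  -- In weight `0` the factor `s (s - 1)` cancels the poles: `s (s - 1) (-1/s - 1/(1 - s)) = 1`, the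
  -- source of the constant in `eisNonpos`.
  rcases Nat.eq_zero_or_pos a with rfl | h0
  · have h1 : s ≠ 0 := by rintro rfl; simp at hre; linarith
    have h2 : (1 : ℂ) - s ≠ 0 := by
      intro h
      have : s = 1 := by linear_combination -h
      simp [this] at hre
    simp only [CharP.cast_eq_zero, zero_div, sub_zero, pow_zero, neg_zero, add_zero, zero_add,
      Complex.cpow_zero]
    field_simp
    ring
  · rw [add_zero, zero_pow (by omega)]
    push_cast
    ring

/-- Writing `1 / u^k = ū^k / |u|^(2k)` turns the series into one with the polynomial `ū^k`, at the
shifted argument `s + k`. -/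
lemma eisPos_eq_series {k : ℕ} (hk : Even k) (hk0 : 0 < k) (z : ℍ) {s : ℂ}
    (hs : 1 - (k : ℝ) / 2 < s.re) : eisPos k z s = doublyCompletedSeries k z s := by
  have hz : 0 < (z : ℂ).im := z.im_pos
  have hpi : (Real.pi : ℂ) ≠ 0 := by exact_mod_cast Real.pi_ne_zero
  have hyc : ((z : ℂ).im : ℂ) ≠ 0 := by exact_mod_cast hz.ne'
  have hsum := (hasSum_entirePart (b := 0) (c := k) (Or.inl rfl) (by simpa using hk) hz
    (s := s + k) (by simp; linarith)).mul_left
    (1 / 2 * (Real.pi : ℂ) ^ ((k : ℂ) / 2) * (((z : ℂ).im : ℂ) ^ k)⁻¹)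
  rw [zero_pow (by omega), zero_div, zero_div, sub_zero, sub_zero] at hsum
  rw [doublyCompletedSeries, eisPos]
  have hL : completedSeries k z s = 1 / 2 * (Real.pi : ℂ) ^ ((k : ℂ) / 2) *
      (((z : ℂ).im : ℂ) ^ k)⁻¹ * entirePart 0 k z (s + k) := by
    rw [← hsum.tsum_eq, completedSeries, eisSeries, ← mul_assoc, ← tsum_mul_left]
    refine tsum_congr fun p => ?_
    have hG : s + ((k : ℤ) : ℂ) / 2 + ((|(k : ℤ)| : ℤ) : ℂ) / 2 = s + k := by
      rw [Nat.abs_cast]; push_cast; ring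
    have hP : (Real.pi : ℂ) ^ (-(s + ((k : ℤ) : ℂ) / 2)) =
        (Real.pi : ℂ) ^ ((k : ℂ) / 2) * (Real.pi : ℂ) ^ (-(s + k)) := by
      rw [← Complex.cpow_add _ _ hpi]; congr 1; push_cast; ring
    have hu : ((p : ℤ × ℤ).1 : ℂ) * z + ((p : ℤ × ℤ).2 : ℂ) = lin p z := rfl
    have hy : z.im = (z : ℂ).im := rfl
    have hu0 := lin_ne_zero p hz
    have hub : conj (lin p z) ≠ 0 := by simpa using hu0
    have hq0 : (quad p z : ℂ) ≠ 0 := by exact_mod_cast (quad_pos p hz).ne'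
    have hys : ((z : ℂ).im : ℂ) ^ s ≠ 0 := by
      simp [Complex.cpow_eq_zero_iff, z.im_ne_zero]
    have hqk : (quad p z : ℂ) ^ k =
        lin p z ^ k * conj (lin p z) ^ k / ((z : ℂ).im : ℂ) ^ k := by
      rw [← mul_pow, mul_conj_lin p hz, mul_pow]; field_simp
    rw [hG, hP, Complex.cpow_add _ _ hq0, Complex.cpow_natCast, hqk, quad_cpow p hz, hu, hy,
      zpow_natCast, pow_zero, one_mul]
    field_simp
  rw [hL]
  push_cast
  ring

lemma eq_of_isEntireContinuation {k : ℤ} {z : ℍ} {g h : ℂ → ℂ} (hg : IsEntireContinuation k z g)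
    (hh : IsEntireContinuation k z h) : g = h := by
  refine AnalyticOnNhd.eq_of_eventuallyEq (z₀ := ((2 - (k : ℝ) / 2 : ℝ) : ℂ))
    (fun s _ => hg.1.analyticAt s) (fun s _ => hh.1.analyticAt s) ?_
  have : ∀ᶠ s : ℂ in 𝓝 ((2 - (k : ℝ) / 2 : ℝ) : ℂ), 1 - (k : ℝ) / 2 < s.re :=
    Complex.continuous_re.continuousAt.eventually (lt_mem_nhds (by
      rw [Complex.ofReal_re]; linarith))
  filter_upwards [this] with s hs
  rw [hg.2 s hs, hh.2 s hs]

lemma isEntireContinuation_eis {k : ℤ} {z : ℍ} {g : ℂ → ℂ} (hg : IsEntireContinuation k z g) :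
    IsEntireContinuation k z (doublyCompletedEis k z) := by
  have h : ∃ g : ℂ → ℂ, IsEntireContinuation k z g := ⟨g, hg⟩
  rw [doublyCompletedEis, dif_pos h]
  exact h.choose_spec

lemma isEntireContinuation_eisNonpos {a : ℕ} (ha : Even a) (z : ℍ) :
    IsEntireContinuation (-(a : ℤ)) z (eisNonpos a z) :=
  ⟨differentiable_eisNonpos ha z.im_pos, fun s hs => eisNonpos_eq_series ha z (by
    push_cast at hs; linarith)⟩

lemma isEntireContinuation_eisPos {k : ℕ} (hk : Even k) (hk0 : 0 < k) (z : ℍ) :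
    IsEntireContinuation k z (eisPos k z) :=
  ⟨differentiable_eisPos hk z.im_pos, fun s hs => eisPos_eq_series hk hk0 z (by
    push_cast at hs; linarith)⟩

lemma doublyCompletedEis_neg {a : ℕ} (ha : Even a) (z : ℍ) :
    doublyCompletedEis (-(a : ℤ)) z = eisNonpos a z :=
  eq_of_isEntireContinuation (isEntireContinuation_eis (isEntireContinuation_eisNonpos ha z))
    (isEntireContinuation_eisNonpos ha z)

lemma doublyCompletedEis_pos {k : ℕ} (hk : Even k) (hk0 : 0 < k) (z : ℍ) :
    doublyCompletedEis k z = eisPos k z :=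
  eq_of_isEntireContinuation (isEntireContinuation_eis (isEntireContinuation_eisPos hk hk0 z))
    (isEntireContinuation_eisPos hk hk0 z)

end Continuation

/-! ### The two differential relations between weights `k` and `2 - k` -/

section Ramp

lemma lap_congr {B : Type*} [NormedAddCommGroup B] [NormedSpace ℂ B] {V W : ℝ → B}
    (h : ∀ t > 1, V t = W t) : lap V = lap W :=
  funext fun _ => setIntegral_congr_fun measurableSet_Ioi fun t ht => by simp only [h t ht]

lemma lap_const_smul {B : Type*} [NormedAddCommGroup B] [NormedSpace ℂ B] (a : ℂ) (W : ℝ → B) :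
    lap (fun t => a • W t) = fun q => a • lap W q := by
  ext q
  simp only [lap, smul_comm _ a]
  exact integral_smul _ _

/-- The factor `t` raises both powers in the kernel by one, which is the shift `(a, s) ↦ (a + 2, s +
1)`; Mellin kernels are thus stable under differentiation in `q`. -/
lemma lap_mul_self_mellinKernel (a : ℕ) (s : ℂ) :
    lap (fun t => (-(Real.pi * t)) • mellinKernel a s t) =
      fun q => (-Real.pi : ℂ) • lap (mellinKernel (a + 2) (s + 1)) q := by
  rw [← lap_const_smul]
  refine lap_congr fun t ht => ?_
  have ht0 : (t : ℂ) ≠ 0 := by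
    have : (0 : ℝ) < t := by linarith
    exact_mod_cast this.ne'
  have h1 : (t : ℂ) ^ (s + 1 - 1) = (t : ℂ) ^ (s - 1) * t := by
    rw [show s + 1 - 1 = s - 1 + 1 by ring, Complex.cpow_add _ _ ht0, Complex.cpow_one]
  have h2 : (t : ℂ) ^ (((a + 2 : ℕ) : ℂ) - (s + 1)) = (t : ℂ) ^ ((a : ℂ) - s) * t := by
    rw [show ((a + 2 : ℕ) : ℂ) - (s + 1) = a - s + 1 by push_cast; ring,
      Complex.cpow_add _ _ ht0, Complex.cpow_one]
  simp only [mellinKernel, h1, h2, Complex.real_smul, smul_eq_mul]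
  push_cast
  ring

lemma differentiableAt_entirePart (b c : ℕ) (s : ℂ) {z : ℂ} (hz : 0 < z.im) :
    DifferentiableAt ℝ (fun w => entirePart b c w s) z :=
  (hasFDerivAt_latSum_lap (polyGrowth_mellinKernel _ _) b c hz).differentiableAt

lemma dbarC_entirePart (b c : ℕ) (s : ℂ) {z : ℂ} (hz : 0 < z.im) :
    dbarC (fun w => entirePart b c w s) z =
      ((c : ℂ) / (2 * Complex.I * z.im)) *
          (latSum (b + 1) (c - 1) (lap (mellinKernel (b + c) s)) z - entirePart b c z s) +
        (Complex.I / (2 * (z.im : ℂ) ^ 2)) * (Real.pi * entirePart (b + 2) c z (s + 1)) := by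
  have h := dbarC_of_hasFDerivAt (hasFDerivAt_latSum_lap (polyGrowth_mellinKernel (b + c) s) b c hz)
  rw [show (fun w => entirePart b c w s) = latSum b c (lap (mellinKernel (b + c) s)) from rfl, h,
    lap_mul_self_mellinKernel]
  simp only [latDeriv]
  rw [latSum_const_smul]
  simp only [smul_eq_mul, entirePart, show b + 2 + c = b + c + 2 by ring]
  ring

lemma conj_mellinKernel (a : ℕ) (s : ℂ) {t : ℝ} (ht : 0 < t) :
    conj (mellinKernel a s t) = mellinKernel a (conj s) t := by
  have h : ∀ w : ℂ, conj ((t : ℂ) ^ w) = (t : ℂ) ^ conj w := fun w => by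
    have := Complex.cpow_conj (t : ℂ) w (by
      rw [Complex.arg_ofReal_of_nonneg ht.le]; exact Real.pi_pos.ne)
    rw [Complex.conj_ofReal] at this
    exact this.symm
  simp only [mellinKernel, map_add, h, map_sub, map_one, Complex.conj_natCast]

lemma conj_entirePart (b c : ℕ) (z s : ℂ) :
    conj (entirePart b c z s) = entirePart c b z (conj s) := by
  rw [entirePart, latSum_conj, entirePart, add_comm c b]
  congr 1
  ext q
  rw [lap, ← integral_conj]
  refine setIntegral_congr_fun measurableSet_Ioi fun t ht => ?_
  simp only [Complex.real_smul, map_mul, Complex.conj_ofReal,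
    conj_mellinKernel _ _ (one_pos.trans ht)]

lemma dbarC_mul {f g : ℂ → ℂ} {z : ℂ} (hf : DifferentiableAt ℝ f z)
    (hg : DifferentiableAt ℝ g z) :
    dbarC (fun w => f w * g w) z = dbarC f z * g z + f z * dbarC g z := by
  have := (hf.hasFDerivAt.mul hg.hasFDerivAt).fderiv
  rw [dbarC, show (fun w => f w * g w) = f * g from rfl, this]
  simp only [dbarC, add_apply, smul_apply, smul_eq_mul]
  ring

lemma hasFDerivAt_im_pow_inv (k : ℕ) {z : ℂ} (hz : 0 < z.im) :
    HasFDerivAt (fun w : ℂ => ((w.im : ℂ) ^ k)⁻¹)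
      (wirtingerL ℂ (k * ((z.im : ℂ) ^ (k + 1))⁻¹ * (Complex.I / 2),
        -(k * ((z.im : ℂ) ^ (k + 1))⁻¹ * (Complex.I / 2)))) z := by
  have hy : (z.im : ℂ) ≠ 0 := by exact_mod_cast hz.ne'
  have h := (hasDerivAt_inv (pow_ne_zero k hy)).comp_hasFDerivAt z ((hasFDerivAt_im z).pow k)
  refine HasFDerivAt.congr_fderiv h ?_
  ext w
  rcases k with _ | k
  · simp [wirtingerL_apply]
  · simp only [wirtingerL_apply, smul_apply, smul_eq_mul, Nat.add_sub_cancel, nsmul_eq_mul]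
    field_simp
    ring

lemma latSum_congr {B : Type*} [NormedAddCommGroup B] [NormedSpace ℂ B] {E F : ℝ → B} (b c : ℕ)
    {z : ℂ} (hz : 0 < z.im) (h : ∀ q > 0, E q = F q) : latSum b c E z = latSum b c F z :=
  tsum_congr fun p => by rw [latTerm, latTerm, h _ (quad_pos p hz)]

/-- From `u ū = y q`: mixed factors are absorbed in the profile, which brings the polynomial back to
a spherical one. -/
lemma latSum_succ_succ (b c : ℕ) (E : ℝ → ℂ) {z : ℂ} (hz : 0 < z.im) :
    latSum (b + 1) (c + 1) E z = z.im * latSum b c (fun q => q * E q) z := by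
  rw [latSum, latSum, ← tsum_mul_left]
  refine tsum_congr fun p => ?_
  simp only [latTerm, smul_eq_mul]
  linear_combination (lin p z ^ b * conj (lin p z) ^ c * E (quad p z)) * mul_conj_lin p hz

/-- Integration by parts in `t`; the Gaussian is the boundary term at `t = 1`. -/
lemma mul_lap_cpow (s : ℂ) {q : ℝ} (hq : 0 < q) :
    Real.pi * q * lap (fun t => (t : ℂ) ^ (s - 1)) q =
      gauss 1 q + (s - 1) * lap (fun t => (t : ℂ) ^ (s - 2)) q := by
  have hpi := Real.pi_pos
  have hpq : 0 < Real.pi * q := by positivity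
  have hint : ∀ w : ℂ, IntegrableOn
      (fun t : ℝ => Real.exp (-(Real.pi * q) * t) • (t : ℂ) ^ w) (Ioi 1) := fun w =>
    (polyGrowth_cpow w).integrableOn hpq
  have hderiv : ∀ t : ℝ, 0 < t → HasDerivAt
      (fun t : ℝ => -((Real.exp (-(Real.pi * q) * t) : ℝ) : ℂ) * (t : ℂ) ^ (s - 1))
      (Real.pi * q * (Real.exp (-(Real.pi * q) * t) • (t : ℂ) ^ (s - 1)) -
        (s - 1) * (Real.exp (-(Real.pi * q) * t) • (t : ℂ) ^ (s - 2))) t := fun t ht => by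
    have h1 : HasDerivAt (fun t : ℝ => -(Real.pi * q) * t) (-(Real.pi * q) * 1) t :=
      (hasDerivAt_id t).const_mul _
    have h2 := h1.exp.ofReal_comp.neg
    have h3 : HasDerivAt (fun t : ℝ => (t : ℂ) ^ (s - 1)) ((s - 1) * (t : ℂ) ^ (s - 1 - 1) * 1) t :=
      HasDerivAt.comp_ofReal ((hasDerivAt_id (t : ℂ)).cpow_const (by
        simpa [Complex.ofReal_mem_slitPlane] using ht))
    refine (h2.mul h3).congr_deriv ?_
    simp only [Complex.real_smul, Pi.neg_apply]
    rw [show s - 1 - 1 = s - 2 by ring]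
    push_cast
    ring
  have htend : Tendsto
      (fun t : ℝ => -((Real.exp (-(Real.pi * q) * t) : ℝ) : ℂ) * (t : ℂ) ^ (s - 1))
      atTop (𝓝 0) := by
    rw [tendsto_zero_iff_norm_tendsto_zero]
    refine (tendsto_rpow_mul_exp_neg_mul_atTop_nhds_zero (s - 1).re _ hpq).congr' ?_
    filter_upwards [eventually_gt_atTop 0] with t ht
    rw [norm_mul, norm_neg, Complex.norm_real, Real.norm_of_nonneg (Real.exp_pos _).le,
      Complex.norm_cpow_eq_rpow_re_of_pos ht, mul_comm]
  have h := integral_Ioi_of_hasDerivAt_of_tendsto (a := (1 : ℝ))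
    (hderiv 1 one_pos).continuousAt.continuousWithinAt
    (fun t ht => hderiv t (one_pos.trans ht))
    (((hint _).const_mul _).sub ((hint _).const_mul _)) htend
  rw [integral_sub ((hint _).const_mul _) ((hint _).const_mul _), integral_const_mul,
    integral_const_mul] at h
  rw [lap, lap]
  have hg : gauss 1 q = ((Real.exp (-(Real.pi * q) * 1) : ℝ) : ℂ) := by
    rw [gauss]; congr 2; ring
  rw [hg]
  simp only [Complex.ofReal_one, Complex.one_cpow] at h
  linear_combination h

lemma lap_mellinKernel (a : ℕ) (s : ℂ) {q : ℝ} (hq : 0 < q) :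
    lap (mellinKernel a s) q =
      lap (fun t => (t : ℂ) ^ (s - 1)) q + lap (fun t => (t : ℂ) ^ ((a : ℂ) - s)) q := by
  have hpq : 0 < Real.pi * q := mul_pos Real.pi_pos hq
  simp only [lap, mellinKernel, smul_add]
  exact integral_add ((polyGrowth_cpow _).integrableOn hpq) ((polyGrowth_cpow _).integrableOn hpq)

/-- Two integrations by parts for each power of the kernel remove every factor `q`, except in the
boundary terms at `t = 1`. -/
lemma lap_mellinKernel_radial (a : ℕ) (s : ℂ) {q : ℝ} (hq : 0 < q) :
    (a + 2) * (q * lap (mellinKernel (a + 2) s) q) -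
        q * (q * (Real.pi * lap (mellinKernel (a + 4) (s + 1)) q)) =
      (a + 2 - s) * (s - 1) / Real.pi * lap (mellinKernel a (s - 1)) q +
        ((a + 1) / Real.pi * gauss 1 q - 2 * (q * gauss 1 q)) := by
  have hpi : (Real.pi : ℂ) ≠ 0 := by exact_mod_cast Real.pi_ne_zero
  have h1 := mul_lap_cpow s hq
  have h2 := mul_lap_cpow (a + 3 - s) hq
  have h3 := mul_lap_cpow (s + 1) hq
  have h4 := mul_lap_cpow (a + 4 - s) hq
  rw [lap_mellinKernel _ _ hq, lap_mellinKernel _ _ hq, lap_mellinKernel _ _ hq]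
  push_cast
  rw [show (s + 1 - 1 : ℂ) = s by ring, show (s + 1 - 2 : ℂ) = s - 1 by ring] at h3
  rw [show (a + 4 - s - 1 : ℂ) = a + 4 - (s + 1) by ring,
    show (a + 4 - s - 2 : ℂ) = a + 2 - s by ring] at h4
  rw [show (a + 3 - s - 1 : ℂ) = a + 2 - s by ring,
    show (a + 3 - s - 2 : ℂ) = a - (s - 1) by ring] at h2
  rw [show (s + 1 - 1 : ℂ) = s by ring, show (s - 1 - 1 : ℂ) = s - 2 by ring]
  field_simp
  linear_combination (a + 2 - s) * h1 + (s - 1) * h2 - Real.pi * q * h3 - Real.pi * q * h4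

lemma latSum_add {b c : ℕ} {E F : ℝ → ℂ} {N : ℝ} (hN : 2 + (b + c : ℕ) < 2 * N)
    (hE : Decays E N) (hF : Decays F N) {z : ℂ} (hz : 0 < z.im) :
    latSum b c (fun q => E q + F q) z = latSum b c E z + latSum b c F z := by
  rw [latSum, latSum, latSum, ← (summable_latTerm hE hN hz).of_norm.tsum_add
    (summable_latTerm hF hN hz).of_norm]
  exact tsum_congr fun p => by simp only [latTerm, smul_eq_mul]; ring

/-- Differentiating the power of `y` cancels the multiple of `entirePart` itself in
`dbarC_entirePart`. The remaining mixed sums are reduced to degree `a` by `latSum_succ_succ` and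
then by `lap_mellinKernel_radial`. -/
lemma dbarC_im_pow_mul_entirePart {a : ℕ} (ha : Even a) (s : ℂ) {z : ℂ} (hz : 0 < z.im) :
    dbarC (fun w => ((w.im : ℂ) ^ (a + 2))⁻¹ * entirePart 0 (a + 2) w s) z =
      -(Complex.I / 2) * ((z.im : ℂ) ^ (a + 2))⁻¹ *
        ((a + 2 - s) * (s - 1) / Real.pi * entirePart 0 a z (s - 1) -
          (a + 1) / Real.pi * 0 ^ a) := by
  have hpi : (Real.pi : ℂ) ≠ 0 := by exact_mod_cast Real.pi_ne_zero
  have hy : (z.im : ℂ) ≠ 0 := by exact_mod_cast hz.ne'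
  have hI := Complex.I_ne_zero
  have him := hasFDerivAt_im_pow_inv (a + 2) hz
  rw [dbarC_mul him.differentiableAt (differentiableAt_entirePart _ _ _ hz),
    dbarC_of_hasFDerivAt him, dbarC_entirePart _ _ _ hz]
  set N : ℝ := 2 + (0 + a : ℕ) with hNdef
  have hN : (2 : ℝ) + (0 + a : ℕ) < 2 * N := by
    have : (0 : ℝ) ≤ (0 + a : ℕ) := Nat.cast_nonneg _
    linarith
  have e1 : latSum (0 + 1) (a + 2 - 1) (lap (mellinKernel (0 + (a + 2)) s)) z =
      z.im * latSum 0 a (fun q => q * lap (mellinKernel (a + 2) s) q) z := by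
    rw [show a + 2 - 1 = a + 1 by omega, show 0 + (a + 2) = a + 2 by omega,
      latSum_succ_succ _ _ _ hz]
  have e2 : entirePart (0 + 2) (a + 2) z (s + 1) = z.im * (z.im *
      latSum 0 a (fun q => q * (q * lap (mellinKernel (a + 4) (s + 1)) q)) z) := by
    rw [entirePart, show 0 + 2 + (a + 2) = a + 4 by omega, show a + 2 = a + 1 + 1 by omega,
      latSum_succ_succ _ _ _ hz, latSum_succ_succ _ _ _ hz]
  have e3 : (a + 2) * latSum 0 a (fun q => q * lap (mellinKernel (a + 2) s) q) z +
      (-Real.pi) * latSum 0 a (fun q => q * (q * lap (mellinKernel (a + 4) (s + 1)) q)) z =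
      (a + 2 - s) * (s - 1) / Real.pi * entirePart 0 a z (s - 1) +
        ((a + 1) / Real.pi * latSum 0 a (gauss 1) z +
          (-2) * latSum 0 a (fun q => (q : ℂ) • gauss 1 q) z) := by
    have hg : Decays (gauss 1) N := decays_gauss one_pos _
    have hqg : Decays (fun q => (q : ℂ) • gauss 1 q) N := (decays_gauss one_pos _).mul_id
    rw [entirePart, zero_add]
    simp only [← smul_eq_mul (a := (a + 2 : ℂ)), ← smul_eq_mul (a := (-Real.pi : ℂ)),
      ← smul_eq_mul (a := ((a + 2 - s) * (s - 1) / Real.pi : ℂ)),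
      ← smul_eq_mul (a := ((a + 1) / Real.pi : ℂ)), ← smul_eq_mul (a := (-2 : ℂ))]
    simp only [← latSum_const_smul]
    have hX : Decays (fun q => (a + 2 : ℂ) • (q * lap (mellinKernel (a + 2) s) q)) N :=
      (decays_lap (polyGrowth_mellinKernel _ _) (N + 1)).mul_id.const_smul _
    have hY : Decays (fun q => (-Real.pi : ℂ) •
        (q * (q * lap (mellinKernel (a + 4) (s + 1)) q))) N :=
      (decays_lap (polyGrowth_mellinKernel _ _) (N + 1 + 1)).mul_id.mul_id.const_smul _
    rw [← latSum_add hN hX hY hz,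
      ← latSum_add hN (hg.const_smul _) (hqg.const_smul _) hz]
    have hgq : Decays (fun q => ((a + 1) / Real.pi : ℂ) • gauss 1 q +
        (-2 : ℂ) • (q : ℂ) • gauss 1 q) N := by
      intro q₀ hq₀
      obtain ⟨C, hC⟩ := hg.const_smul ((a + 1) / Real.pi : ℂ) q₀ hq₀
      obtain ⟨D, hD⟩ := hqg.const_smul (-2 : ℂ) q₀ hq₀
      exact ⟨C + D, fun q hq => (norm_add_le _ _).trans (by
        rw [add_mul]; exact add_le_add (hC q hq) (hD q hq))⟩
    rw [← latSum_add hN ((decays_lap (polyGrowth_mellinKernel _ _) _).const_smul _) hgq hz]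
    refine latSum_congr _ _ hz fun q hq => ?_
    have := lap_mellinKernel_radial a s hq
    simp only [smul_eq_mul]
    linear_combination this
  -- The theta inversion, differentiated at `t = 1`, collapses the boundary terms to a constant,
  -- nonzero only for `a = 0`.
  have e4 := theta_inv_deriv (b := 0) (c := a) (Or.inl rfl) (by simpa using ha) hz
  rw [zero_add] at e4
  rw [e1, e2]
  push_cast
  set X := latSum 0 a (fun q => q * lap (mellinKernel (a + 2) s) q) z
  set Y := latSum 0 a (fun q => q * (q * lap (mellinKernel (a + 4) (s + 1)) q)) z
  have e5 : (a + 2) * X - Real.pi * Y =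
      (a + 2 - s) * (s - 1) / Real.pi * entirePart 0 a z (s - 1) - (a + 1) / Real.pi * 0 ^ a := by
    field_simp at e3 ⊢
    linear_combination e3 - e4
  rw [← e5]
  have hinv : (2 * Complex.I * z.im)⁻¹ = -(Complex.I / 2) * (z.im : ℂ)⁻¹ := by
    rw [mul_inv, mul_inv, Complex.inv_I]; ring
  rw [div_eq_mul_inv ((a : ℂ) + 2), hinv]
  field_simp
  ring

/-- The relation between the weights `2 - k` and `k`, as an identity of entire functions. -/
lemma dbarC_eisNonpos (a : ℕ) (s : ℂ) {z : ℂ} (hz : 0 < z.im) :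
    dbarC (fun w => eisNonpos a w s) z =
      Complex.I / 2 * (z.im : ℂ) ^ a * conj (eisPos (a + 2) z (-conj s)) := by
  have hpi : (Real.pi : ℂ) ≠ 0 := by exact_mod_cast Real.pi_ne_zero
  have hy : (z.im : ℂ) ≠ 0 := by exact_mod_cast hz.ne'
  have hd := differentiableAt_entirePart a 0 s hz
  have h1 : dbarC (fun w => eisNonpos a w s) z =
      ((s - a / 2) * (s - a / 2 - 1) * (1 / 2 * (Real.pi : ℂ) ^ ((a : ℂ) / 2))) *
        dbarC (fun w => entirePart a 0 w s) z := by
    rw [← smul_eq_mul, ← dbarC_const_smul hd, ← add_zero (dbarC (fun w => _ • _) z),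
      ← dbarC_const (1 / 2 * 0 ^ a : ℂ) z,
      ← dbarC_add (hd.fun_const_smul (_ : ℂ)) (differentiableAt_const _)]
    congr 1
    ext w
    rw [eisNonpos, smul_eq_mul]
    ring
  -- The functional equation moves the argument from `-s̄` to `1 - k + s̄`, so that `entirePart` is
  -- taken at the conjugate of `s + 1`, as on the left.
  rw [h1, dbarC_entirePart _ _ _ hz, ← eisPos_symm, eisPos,
    show (1 - ((a + 2 : ℕ) : ℂ) - -conj s + ((a + 2 : ℕ) : ℂ)) = conj (s + 1) by
      simp; ring, ← conj_entirePart (a + 2) 0]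
  have hpip : conj ((Real.pi : ℂ) ^ (((a + 2 : ℕ) : ℂ) / 2)) =
      (Real.pi : ℂ) ^ ((a : ℂ) / 2) * Real.pi := by
    rw [show ((a + 2 : ℕ) : ℂ) / 2 = (((a : ℝ) / 2 + 1 : ℝ) : ℂ) by push_cast; ring,
      ← Complex.ofReal_cpow Real.pi_pos.le, Complex.conj_ofReal,
      Complex.ofReal_cpow Real.pi_pos.le]
    push_cast
    rw [Complex.cpow_add _ _ hpi, Complex.cpow_one]
  simp only [map_mul, map_add, map_sub, map_neg, map_one, map_div₀, map_inv₀, map_pow,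
    Complex.conj_conj, Complex.conj_ofReal, Complex.conj_natCast, map_ofNat, hpip]
  push_cast
  field_simp
  ring

/-- The relation between the weights `k` and `2 - k`, as an identity of entire functions. -/
lemma dbarC_eisPos {a : ℕ} (ha : Even a) (s : ℂ) {z : ℂ} (hz : 0 < z.im) :
    dbarC (fun w => eisPos (a + 2) w s) z =
      Complex.I / 2 * ((z.im : ℂ) ^ (a + 2))⁻¹ *
        (s * (s + (a + 1)) * conj (eisNonpos a z (-conj s))) := by
  have hpi : (Real.pi : ℂ) ≠ 0 := by exact_mod_cast Real.pi_ne_zero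
  have hy : (z.im : ℂ) ≠ 0 := by exact_mod_cast hz.ne'
  have hd : DifferentiableAt ℝ (fun w : ℂ => ((w.im : ℂ) ^ (a + 2))⁻¹ *
      entirePart 0 (a + 2) w (s + (a + 2 : ℕ))) z :=
    (hasFDerivAt_im_pow_inv (a + 2) hz).differentiableAt.mul (differentiableAt_entirePart _ _ _ hz)
  have h1 : dbarC (fun w => eisPos (a + 2) w s) z =
      ((s + (a + 2 : ℕ) / 2) * (s + (a + 2 : ℕ) / 2 - 1) *
        (1 / 2 * (Real.pi : ℂ) ^ (((a + 2 : ℕ) : ℂ) / 2))) *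
        dbarC (fun w : ℂ => ((w.im : ℂ) ^ (a + 2))⁻¹ *
          entirePart 0 (a + 2) w (s + (a + 2 : ℕ))) z := by
    rw [← smul_eq_mul, ← dbarC_const_smul hd]
    congr 1
    ext w
    rw [eisPos, smul_eq_mul]
    ring
  have h2 : entirePart 0 a z (s + (a + 2 : ℕ) - 1) = entirePart 0 a z (-s) := by
    rw [← entirePart_symm]
    congr 1
    push_cast
    ring
  rw [h1, dbarC_im_pow_mul_entirePart ha _ hz, h2, eisNonpos]
  have hpip : conj ((Real.pi : ℂ) ^ ((a : ℂ) / 2)) = (Real.pi : ℂ) ^ ((a : ℂ) / 2) := by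
    rw [show (a : ℂ) / 2 = (((a : ℝ) / 2 : ℝ) : ℂ) by push_cast; ring,
      ← Complex.ofReal_cpow Real.pi_pos.le, Complex.conj_ofReal]
  have hpip2 : (Real.pi : ℂ) ^ (((a + 2 : ℕ) : ℂ) / 2) =
      (Real.pi : ℂ) ^ ((a : ℂ) / 2) * Real.pi := by
    rw [show ((a + 2 : ℕ) : ℂ) / 2 = a / 2 + 1 by push_cast; ring, Complex.cpow_add _ _ hpi,
      Complex.cpow_one]
  simp only [map_mul, map_add, map_sub, map_neg, map_one, map_div₀, map_pow, map_zero,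
    Complex.conj_conj, Complex.conj_natCast, map_ofNat, hpip, hpip2, conj_entirePart]
  rcases Nat.eq_zero_or_pos a with rfl | h0
  · simp
    field_simp
    ring
  · rw [zero_pow (by omega)]
    push_cast
    field_simp
    ring

end Ramp

/-! ### Taylor coefficients as continuous functionals on the circle -/

section Taylor

/-- The `n`-th Taylor coefficient at `0`. -/
def taylorAt (f : ℂ → ℂ) (n : ℕ) : ℂ := iteratedDeriv n f 0 / (n.factorial : ℂ)

lemma hasSum_taylorAt {f : ℂ → ℂ} (hf : Differentiable ℂ f) (s : ℂ) :
    HasSum (fun n => taylorAt f n * s ^ n) (f s) := by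
  have h := Complex.hasSum_taylorSeries_of_entire hf 0 s
  have he : (fun n => taylorAt f n * s ^ n) =
      fun n : ℕ => (n.factorial : ℂ)⁻¹ • (s - 0) ^ n • iteratedDeriv n f 0 := by
    ext n
    rw [taylorAt, smul_eq_mul, smul_eq_mul, sub_zero, div_eq_mul_inv]
    ring
  rw [he]
  exact h

lemma taylorAt_unique {f : ℂ → ℂ} (hf : Differentiable ℂ f) {a : ℕ → ℂ}
    (ha : ∀ s, ‖s‖ < 1 → HasSum (fun n => a n * s ^ n) (f s)) (n : ℕ) : taylorAt f n = a n := by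
  have key : ∀ b : ℕ → ℂ, (∀ s, ‖s‖ < 1 → HasSum (fun n => b n * s ^ n) (f s)) →
      HasFPowerSeriesAt f (FormalMultilinearSeries.ofScalars ℂ b) 0 := fun b hb => by
    rw [hasFPowerSeriesAt_iff]
    filter_upwards [Metric.ball_mem_nhds (0 : ℂ) one_pos] with s hs
    simpa [FormalMultilinearSeries.coeff_ofScalars, mul_comm] using hb s (by simpa using hs)
  have h := (key _ fun s _ => hasSum_taylorAt hf s).eq_formalMultilinearSeries (key a ha)
  have h2 := congrArg (fun p => FormalMultilinearSeries.coeff p n) h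
  simpa [FormalMultilinearSeries.coeff_ofScalars] using h2

lemma taylorAt_cauchy {f : ℂ → ℂ} (hf : Differentiable ℂ f) (n : ℕ) :
    taylorAt f n = (2 * Real.pi * Complex.I : ℂ)⁻¹ * ∫ θ in (0 : ℝ)..2 * Real.pi,
      (deriv (circleMap 0 1) θ * ((circleMap 0 1 θ)⁻¹ ^ n * (circleMap 0 1 θ)⁻¹)) *
        f (circleMap 0 1 θ) := by
  have h := (hf.diffContOnCl (s := Metric.ball 0 1)).hasFPowerSeriesOnBall (R := 1) one_pos
  refine taylorAt_unique hf (a := fun n => (2 * Real.pi * Complex.I : ℂ)⁻¹ *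
    ∫ θ in (0 : ℝ)..2 * Real.pi,
      (deriv (circleMap 0 1) θ * ((circleMap 0 1 θ)⁻¹ ^ n * (circleMap 0 1 θ)⁻¹)) *
        f (circleMap 0 1 θ)) (fun s hs => ?_) n
  have h2 := h.hasSum (y := s) (by simpa [enorm_eq_nnnorm, ← NNReal.coe_lt_coe] using hs)
  rw [zero_add] at h2
  refine (congrArg (fun g => HasSum g (f s)) (funext fun m => ?_)).mp h2
  rw [cauchyPowerSeries_apply, smul_eq_mul, mul_assoc (2 * Real.pi * Complex.I : ℂ)⁻¹]
  congr 1
  rw [circleIntegral, ← intervalIntegral.integral_mul_const]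
  congr 1
  ext θ
  simp only [smul_eq_mul, sub_zero, div_eq_mul_inv, mul_pow, NNReal.coe_one]
  ring

/-- The parameter interval of the unit circle. -/
abbrev CircleParam : Type := Icc (0 : ℝ) (2 * Real.pi)

/-- Integration over the circle against a continuous weight, as a continuous functional. -/
lemma exists_clm_integral (g : ℝ → ℂ) (hg : Continuous g) :
    ∃ T : C(CircleParam, ℂ) →L[ℂ] ℂ, ∀ φ, T φ = ∫ θ in (0 : ℝ)..2 * Real.pi,
      g θ * φ (projIcc 0 (2 * Real.pi) Real.two_pi_pos.le θ) := by
  obtain ⟨C, hC⟩ := isCompact_Icc.exists_bound_of_continuousOn (s := Icc 0 (2 * Real.pi))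
    hg.continuousOn
  have hcont : ∀ φ : C(CircleParam, ℂ), Continuous fun θ : ℝ =>
      g θ * φ (projIcc 0 (2 * Real.pi) Real.two_pi_pos.le θ) := fun φ =>
    hg.mul (φ.continuous.comp continuous_projIcc)
  refine ⟨LinearMap.mkContinuous
    { toFun := fun φ => ∫ θ in (0 : ℝ)..2 * Real.pi,
        g θ * φ (projIcc 0 (2 * Real.pi) Real.two_pi_pos.le θ)
      map_add' := fun φ ψ => ?_
      map_smul' := fun r φ => ?_ } (C * (2 * Real.pi)) fun φ => ?_, fun φ => rfl⟩
  · rw [← intervalIntegral.integral_add ((hcont φ).intervalIntegrable _ _)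
      ((hcont ψ).intervalIntegrable _ _)]
    simp [mul_add]
  · rw [RingHom.id_apply, smul_eq_mul, ← intervalIntegral.integral_const_mul]
    congr 1
    ext θ
    simp
    ring
  · have h := intervalIntegral.norm_integral_le_of_norm_le_const (a := (0 : ℝ))
      (b := 2 * Real.pi) (C := C * ‖φ‖)
      (f := fun θ => g θ * φ (projIcc 0 (2 * Real.pi) Real.two_pi_pos.le θ)) (fun θ hθ => by
        rw [uIoc_of_le Real.two_pi_pos.le] at hθ
        rw [norm_mul]
        have h1 := hC θ ⟨hθ.1.le, hθ.2⟩
        exact mul_le_mul h1 (φ.norm_coe_le_norm _) (norm_nonneg _) ((norm_nonneg _).trans h1))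
    rw [sub_zero, abs_of_pos Real.two_pi_pos] at h
    refine h.trans (le_of_eq ?_)
    ring

/-- By Cauchy's formula the coefficient depends only on the values on the unit circle, linearly and
continuously for the sup norm. -/
lemma exists_clm_taylorAt (n : ℕ) : ∃ T : C(CircleParam, ℂ) →L[ℂ] ℂ,
    ∀ (φ : C(CircleParam, ℂ)) (f : ℂ → ℂ), Differentiable ℂ f →
      (∀ θ : CircleParam, φ θ = f (circleMap 0 1 θ)) → T φ = taylorAt f n := by
  have hne : ∀ θ, circleMap (0 : ℂ) 1 θ ≠ 0 := fun θ => circleMap_ne_center one_ne_zero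
  have hc : Continuous fun θ => (2 * Real.pi * Complex.I : ℂ)⁻¹ *
      (deriv (circleMap 0 1) θ * ((circleMap 0 1 θ)⁻¹ ^ n * (circleMap 0 1 θ)⁻¹)) := by
    have h1 : Continuous fun θ => (circleMap (0 : ℂ) 1 θ)⁻¹ := (continuous_circleMap 0 1).inv₀ hne
    have h2 : Continuous (deriv (circleMap (0 : ℂ) 1)) := by
      have : deriv (circleMap (0 : ℂ) 1) = fun θ => circleMap 0 1 θ * Complex.I := by
        ext θ; exact deriv_circleMap 0 1 θ
      rw [this]
      fun_prop
    fun_prop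
  obtain ⟨T, hT⟩ := exists_clm_integral _ hc
  refine ⟨T, fun φ f hf h => ?_⟩
  rw [hT, taylorAt_cauchy hf, ← intervalIntegral.integral_const_mul]
  refine intervalIntegral.integral_congr fun θ hθ => ?_
  rw [uIcc_of_le Real.two_pi_pos.le] at hθ
  rw [projIcc_of_mem _ hθ, h ⟨θ, hθ⟩]
  ring

/-- Taylor coefficients inherit smoothness from a smooth family of functions on the circle, and
they commute with the Wirtinger derivative. -/
lemma taylorAt_smooth {H : ℂ → ℂ → ℂ} (hH : ∀ z, 0 < z.im → Differentiable ℂ (H z))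
    {Φ : ℂ → C(CircleParam, ℂ)} (hΦ : ContDiffOn ℝ ∞ Φ {z : ℂ | 0 < z.im})
    (hΦH : ∀ z, 0 < z.im → ∀ θ : CircleParam, Φ z θ = H z (circleMap 0 1 θ)) (n : ℕ) :
    ContDiffOn ℝ ∞ (fun z => taylorAt (H z) n) {z : ℂ | 0 < z.im} ∧
    ∀ z, 0 < z.im → ∀ H' : ℂ → ℂ, Differentiable ℂ H' →
      (∀ s, dbarC (fun w => H w s) z = H' s) →
        dbarC (fun w => taylorAt (H w) n) z = taylorAt H' n := by
  obtain ⟨T, hT⟩ := exists_clm_taylorAt n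
  have heq : ∀ z, 0 < z.im → taylorAt (H z) n = T (Φ z) := fun z hz =>
    (hT _ _ (hH z hz) (hΦH z hz)).symm
  refine ⟨((T.restrictScalars ℝ).contDiff.comp_contDiffOn hΦ).congr fun z hz => heq z hz, ?_⟩
  intro z hz H' hH' hd
  have hdiff : DifferentiableAt ℝ Φ z :=
    (hΦ.contDiffAt (isOpen_im_pos.mem_nhds hz)).differentiableAt (by simp)
  have hev : ∀ᶠ w in 𝓝 z, 0 < w.im := isOpen_im_pos.mem_nhds hz
  rw [dbarC_congr (hev.mono fun w hw => heq w hw), dbarC_clm T hdiff]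
  refine hT _ _ hH' fun θ => ?_
  -- Evaluation at a point of the circle is itself continuous and linear, so `∂Φ/∂z̄` may be
  -- computed pointwise in `s`.
  rw [← hd, dbarC_congr (g := fun w => ContinuousMap.evalCLM ℂ θ (Φ w))
    (hev.mono fun w hw => (hΦH w hw θ).symm), dbarC_clm _ hdiff]
  rfl

end Taylor

/-! ### Lattice sums with values in continuous functions of `s` -/

section Family

variable {K : Type*} [TopologicalSpace K]

/-- The Mellin kernel with `s` varying over a compact parameter space. -/
def mellinKernelFamily (a : ℕ) (σ : C(K, ℂ)) (t : ℝ) : C(K, ℂ) where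
  -- With `exp` and `log`, continuity in `κ` holds for every real `t`; only `t > 1` enters the
  -- integrals, where this is the Mellin kernel.
  toFun κ := Complex.exp ((σ κ - 1) * Real.log t) + Complex.exp ((a - σ κ) * Real.log t)
  continuous_toFun := by fun_prop

lemma mellinKernelFamily_apply (a : ℕ) (σ : C(K, ℂ)) {t : ℝ} (ht : 0 < t) (κ : K) :
    mellinKernelFamily a σ t κ = mellinKernel a (σ κ) t := by
  have ht0 : (t : ℂ) ≠ 0 := by exact_mod_cast ht.ne'
  rw [mellinKernel, Complex.cpow_def_of_ne_zero ht0, Complex.cpow_def_of_ne_zero ht0,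
    ← Complex.ofReal_log ht.le, mul_comm _ (σ κ - 1), mul_comm _ ((a : ℂ) - σ κ)]
  rfl

variable [CompactSpace K]

lemma polyGrowth_mellinKernelFamily (a : ℕ) (σ : C(K, ℂ)) :
    PolyGrowth (mellinKernelFamily a σ) where
  cont := by
    rw [continuousOn_iff_continuous_domRestrict]
    refine ContinuousMap.continuous_of_continuous_uncurry _ ?_
    have h : Continuous fun p : Ioi (1 : ℝ) × K => Real.log p.1 :=
      (continuous_subtype_val.comp continuous_fst).log fun p =>
        (one_pos.trans (mem_Ioi.1 p.1.2)).ne'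
    have : Continuous fun p : Ioi (1 : ℝ) × K =>
        Complex.exp ((σ p.2 - 1) * Real.log p.1) + Complex.exp ((a - σ p.2) * Real.log p.1) := by
      fun_prop
    exact this
  bound := by
    refine ⟨2, ⌈‖σ‖ + 1 + a⌉₊, by norm_num, fun t ht => ?_⟩
    have ht0 : 0 < t := one_pos.trans ht
    have hle : ∀ w : ℂ, ‖w‖ ≤ ‖σ‖ + 1 + a →
        ‖Complex.exp (w * Real.log t)‖ ≤ t ^ ⌈‖σ‖ + 1 + a⌉₊ := fun w hw => by
      rw [Complex.norm_exp, Complex.re_mul_ofReal, mul_comm, Real.exp_mul, Real.exp_log ht0,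
        ← Real.rpow_natCast]
      exact Real.rpow_le_rpow_of_exponent_le ht.le
        ((Complex.re_le_norm w).trans (hw.trans (Nat.le_ceil _)))
    rw [ContinuousMap.norm_le _ (by positivity)]
    intro κ
    have hσ : ‖σ κ‖ ≤ ‖σ‖ := σ.norm_coe_le_norm κ
    have ha : (0 : ℝ) ≤ a := a.cast_nonneg
    have h1 := hle (σ κ - 1) ((norm_sub_le _ _).trans (by rw [norm_one]; linarith))
    have h2 := hle (a - σ κ) ((norm_sub_le _ _).trans (by rw [Complex.norm_natCast]; linarith))
    rw [two_mul]
    exact (norm_add_le _ _).trans (add_le_add h1 h2)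

/-- Evaluation at `κ` is a continuous linear map, hence passes through both the lattice sum and the
integral. -/
lemma latSum_family_apply (b c : ℕ) (σ : C(K, ℂ)) {z : ℂ} (hz : 0 < z.im) (κ : K) :
    latSum b c (lap (mellinKernelFamily (b + c) σ)) z κ = entirePart b c z (σ κ) := by
  have hW := polyGrowth_mellinKernelFamily (b + c) σ
  have hN : (2 : ℝ) + (b + c : ℕ) < 2 * (2 + (b + c : ℕ)) := by
    have : (0 : ℝ) ≤ (b + c : ℕ) := Nat.cast_nonneg _
    linarith
  have hs := (summable_latTerm (b := b) (c := c) (decays_lap hW _) hN hz).of_norm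
  have h := (ContinuousMap.evalCLM ℂ κ).map_tsum hs
  rw [latSum, show (∑' p : Pairs, latTerm b c (lap (mellinKernelFamily (b + c) σ)) z p) κ = _
    from h, entirePart, latSum]
  refine tsum_congr fun p => ?_
  have hq := mul_pos Real.pi_pos (quad_pos p hz)
  have hi := (ContinuousMap.evalCLM ℂ κ).integral_comp_comm (hW.integrableOn hq)
  rw [latTerm, map_smul, lap, ← hi, latTerm, lap]
  congr 1
  refine setIntegral_congr_fun measurableSet_Ioi fun t ht => ?_
  simp only [ContinuousMap.evalCLM_apply, ContinuousMap.smul_apply]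
  rw [mellinKernelFamily_apply _ _ (one_pos.trans ht)]

end Family

/-! ### Smooth dependence of the Eisenstein series on `z`, uniformly over the circle -/

section EisensteinTaylor

/-- The unit circle. -/
def unitCircle : C(CircleParam, ℂ) := ⟨fun θ => circleMap 0 1 θ, by fun_prop⟩

lemma exists_family_eisNonpos (a : ℕ) : ∃ Φ : ℂ → C(CircleParam, ℂ),
    ContDiffOn ℝ ∞ Φ {z : ℂ | 0 < z.im} ∧
    ∀ z, 0 < z.im → ∀ θ : CircleParam, Φ z θ = eisNonpos a z (circleMap 0 1 θ) := by
  let P : C(CircleParam, ℂ) := ⟨fun θ => (circleMap 0 1 θ - a / 2) * (circleMap 0 1 θ - a / 2 - 1) *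
    (1 / 2 * (Real.pi : ℂ) ^ ((a : ℂ) / 2)), by fun_prop⟩
  let Q : C(CircleParam, ℂ) := ContinuousMap.const _ (1 / 2 * 0 ^ a)
  refine ⟨fun z => P * latSum a 0 (lap (mellinKernelFamily (a + 0) unitCircle)) z + Q, ?_, ?_⟩
  · exact (contDiffOn_const.mul
      (contDiffOn_latSum_lap (polyGrowth_mellinKernelFamily _ _) a 0)).add contDiffOn_const
  · intro z hz θ
    rw [ContinuousMap.add_apply, ContinuousMap.mul_apply, latSum_family_apply _ _ _ hz, eisNonpos]
    simp only [P, Q, unitCircle, ContinuousMap.coe_mk, ContinuousMap.const_apply]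
    ring

lemma exists_family_eisPos (k : ℕ) : ∃ Φ : ℂ → C(CircleParam, ℂ),
    ContDiffOn ℝ ∞ Φ {z : ℂ | 0 < z.im} ∧
    ∀ z, 0 < z.im → ∀ θ : CircleParam, Φ z θ = eisPos k z (circleMap 0 1 θ) := by
  let P : C(CircleParam, ℂ) := ⟨fun θ => (circleMap 0 1 θ + k / 2) * (circleMap 0 1 θ + k / 2 - 1) *
    (1 / 2 * (Real.pi : ℂ) ^ ((k : ℂ) / 2)), by fun_prop⟩
  let σ : C(CircleParam, ℂ) := ⟨fun θ => circleMap 0 1 θ + k, by fun_prop⟩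
  refine ⟨fun z => ((z.im : ℂ) ^ k)⁻¹ • (P * latSum 0 k (lap (mellinKernelFamily (0 + k) σ)) z),
    ?_, ?_⟩
  · have him : ContDiffOn ℝ ∞ (fun z : ℂ => ((z.im : ℂ) ^ k)⁻¹) {z : ℂ | 0 < z.im} :=
      ((Complex.ofRealCLM.contDiff.comp Complex.imCLM.contDiff).contDiffOn.pow k).inv fun z hz => by
        have : 0 < z.im := hz
        exact pow_ne_zero _ (by simpa using this.ne')
    exact him.smul (contDiffOn_const.mul
      (contDiffOn_latSum_lap (polyGrowth_mellinKernelFamily _ _) 0 k))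
  · intro z hz θ
    rw [ContinuousMap.smul_apply, ContinuousMap.mul_apply, latSum_family_apply _ _ _ hz, eisPos]
    simp only [P, σ, ContinuousMap.coe_mk, smul_eq_mul]
    ring

end EisensteinTaylor

/-! ### Coefficient comparison in the differential relations -/

section TaylorRamp

/-- The sequence `0, b 0, b 1, …`. -/
def shiftSeq (b : ℕ → ℂ) : ℕ → ℂ
  | 0 => 0
  | n + 1 => b n

/-- Multiplying a power series by `s` shifts its coefficients. -/
lemma hasSum_shiftSeq {b : ℕ → ℂ} {s x : ℂ} (h : HasSum (fun n => b n * s ^ n) x) :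
    HasSum (fun n => shiftSeq b n * s ^ n) (s * x) := by
  have h2 := (hasSum_nat_add_iff (f := fun n => shiftSeq b n * s ^ n) (g := s * x) 1).1
  simp only [Finset.sum_range_one, shiftSeq, zero_mul, add_zero] at h2
  refine h2 ((congrArg (fun f => HasSum f (s * x)) (funext fun n => ?_)).mp (h.mul_left s))
  ring

lemma differentiable_conj_neg_conj {f : ℂ → ℂ} (hf : Differentiable ℂ f) :
    Differentiable ℂ fun s => conj (f (-conj s)) := by
  intro s
  have h : DifferentiableAt ℂ (fun s => f (-s)) (conj s) :=
    (hf _).comp _ differentiableAt_id.neg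
  have h2 := h.conj_conj
  simpa [Function.comp_def] using h2

lemma hasSum_conj_neg_conj {f : ℂ → ℂ} (hf : Differentiable ℂ f) (s : ℂ) :
    HasSum (fun n => (-1) ^ n * conj (taylorAt f n) * s ^ n) (conj (f (-conj s))) := by
  have h := (hasSum_taylorAt hf (-conj s)).map (starRingEnd ℂ) Complex.continuous_conj
  refine (congrArg (fun g => HasSum g _) (funext fun n => ?_)).mp h
  simp only [Function.comp_apply, map_mul, map_pow, map_neg, Complex.conj_conj, neg_pow s]
  ring

lemma dbarC_taylorAt_eisNonpos {a : ℕ} (ha : Even a) (n : ℕ) {z : ℂ} (hz : 0 < z.im) :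
    dbarC (fun w => taylorAt (eisNonpos a w) n) z =
      Complex.I / 2 * (z.im : ℂ) ^ a * ((-1) ^ n * conj (taylorAt (eisPos (a + 2) z) n)) := by
  obtain ⟨Φ, hΦ, hΦH⟩ := exists_family_eisNonpos a
  have hk : Even (a + 2) := ha.add even_two
  have hd := differentiable_eisPos hk hz
  have hH' : Differentiable ℂ fun s =>
      Complex.I / 2 * (z.im : ℂ) ^ a * conj (eisPos (a + 2) z (-conj s)) :=
    (differentiable_conj_neg_conj hd).const_mul _
  rw [(taylorAt_smooth (fun z hz => differentiable_eisNonpos ha hz) hΦ hΦH n).2 z hz _ hH'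
    fun s => dbarC_eisNonpos a s hz]
  refine taylorAt_unique hH' (a := fun n =>
    Complex.I / 2 * (z.im : ℂ) ^ a * ((-1) ^ n * conj (taylorAt (eisPos (a + 2) z) n)))
    (fun s _ => ?_) n
  simpa only [mul_assoc] using (hasSum_conj_neg_conj hd s).mul_left
    (Complex.I / 2 * (z.im : ℂ) ^ a)

/-- The factor `s (s + a + 1) = (a + 1) s + s²` accounts for the single and the double shift. -/
lemma dbarC_taylorAt_eisPos {a : ℕ} (ha : Even a) (n : ℕ) {z : ℂ} (hz : 0 < z.im) :
    dbarC (fun w => taylorAt (eisPos (a + 2) w) n) z =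
      Complex.I / 2 * ((z.im : ℂ) ^ (a + 2))⁻¹ *
        ((a + 1) * shiftSeq (fun m => (-1) ^ m * conj (taylorAt (eisNonpos a z) m)) n +
          shiftSeq (shiftSeq fun m => (-1) ^ m * conj (taylorAt (eisNonpos a z) m)) n) := by
  obtain ⟨Φ, hΦ, hΦH⟩ := exists_family_eisPos (a + 2)
  have hk : Even (a + 2) := ha.add even_two
  have hd := differentiable_eisNonpos ha hz
  have hH' : Differentiable ℂ fun s => Complex.I / 2 * ((z.im : ℂ) ^ (a + 2))⁻¹ *
      (s * (s + (a + 1)) * conj (eisNonpos a z (-conj s))) :=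
    ((differentiable_id.mul (differentiable_id.add_const _)).mul
      (differentiable_conj_neg_conj hd)).const_mul _
  rw [(taylorAt_smooth (fun z hz => differentiable_eisPos hk hz) hΦ hΦH n).2 z hz _ hH'
    fun s => dbarC_eisPos ha s hz]
  set b : ℕ → ℂ := fun m => (-1) ^ m * conj (taylorAt (eisNonpos a z) m) with hb
  refine taylorAt_unique hH' (a := fun n => Complex.I / 2 * ((z.im : ℂ) ^ (a + 2))⁻¹ *
    ((a + 1) * shiftSeq b n + shiftSeq (shiftSeq b) n)) (fun s _ => ?_) n
  have h0 : HasSum (fun n => b n * s ^ n) _ := hasSum_conj_neg_conj hd s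
  have h1 := hasSum_shiftSeq h0
  have h2 := ((h1.mul_left ((a : ℂ) + 1)).add (hasSum_shiftSeq h1)).mul_left
    (Complex.I / 2 * ((z.im : ℂ) ^ (a + 2))⁻¹)
  rw [show s * (s + (a + 1)) * conj (eisNonpos a z (-conj s)) =
    (a + 1) * (s * conj (eisNonpos a z (-conj s))) + s * (s * conj (eisNonpos a z (-conj s))) by
    ring]
  refine (congrArg (fun g => HasSum g _) (funext fun n => ?_)).mp h2
  ring

end TaylorRamp

end PolyMaass

end

noncomputable section
namespace PolyMaass

open Filter Topology Set UpperHalfPlane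

/-! ### The operators `ξ` and `Δ` on smooth functions -/

section Operators

lemma coe_ofComplex {w : ℂ} (hw : 0 < w.im) : (ofComplex w : ℂ) = w := by
  rw [ofComplex_apply_of_im_pos hw]

lemma eventually_im_pos (z : ℍ) : ∀ᶠ w : ℂ in 𝓝 (z : ℂ), 0 < w.im :=
  isOpen_im_pos.mem_nhds z.im_pos

lemma IsSmooth.contDiffAt {f : ℍ → ℂ} (hf : IsSmooth f) {w : ℂ} (hw : 0 < w.im) :
    ContDiffAt ℝ ∞ (fun w : ℂ => f (ofComplex w)) w :=
  ContDiffOn.contDiffAt hf (isOpen_im_pos.mem_nhds hw)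

lemma IsSmooth.differentiableAt {f : ℍ → ℂ} (hf : IsSmooth f) {w : ℂ} (hw : 0 < w.im) :
    DifferentiableAt ℝ (fun w : ℂ => f (ofComplex w)) w :=
  (hf.contDiffAt hw).differentiableAt (by simp)

lemma IsSmooth.const_mul {f : ℍ → ℂ} (hf : IsSmooth f) (r : ℂ) :
    IsSmooth fun z => r * f z :=
  ContDiffOn.mul contDiffOn_const hf

lemma IsSmooth.sum {ι : Type*} {s : Finset ι} {f : ι → ℍ → ℂ} (hf : ∀ i ∈ s, IsSmooth (f i)) :
    IsSmooth fun z => ∑ i ∈ s, f i z :=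
  ContDiffOn.sum hf

lemma IsSmooth.partialX_eq {f : ℍ → ℂ} (hf : IsSmooth f) (z : ℍ) :
    partialX f z = fderiv ℝ (fun w : ℂ => f (ofComplex w)) z 1 :=
  (hf.differentiableAt z.im_pos).lineDeriv_eq_fderiv

lemma IsSmooth.partialY_eq {f : ℍ → ℂ} (hf : IsSmooth f) (z : ℍ) :
    partialY f z = fderiv ℝ (fun w : ℂ => f (ofComplex w)) z Complex.I :=
  (hf.differentiableAt z.im_pos).lineDeriv_eq_fderiv

lemma IsSmooth.dbar_eq {f : ℍ → ℂ} (hf : IsSmooth f) (z : ℍ) :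
    dbar f z = dbarC (fun w : ℂ => f (ofComplex w)) z := by
  rw [dbar, hf.partialX_eq, hf.partialY_eq, dbarC, smul_eq_mul, smul_eq_mul]

lemma xi_const_mul {f : ℍ → ℂ} (hf : IsSmooth f) (k : ℤ) (r : ℂ) (z : ℍ) :
    xi k (fun w => r * f w) z = conj r * xi k f z := by
  have h := dbarC_const_smul (hf.differentiableAt z.im_pos) r
  simp only [smul_eq_mul] at h
  rw [xi, xi, (hf.const_mul r).dbar_eq, hf.dbar_eq, h, map_mul]
  ring

lemma xi_add {f g : ℍ → ℂ} (hf : IsSmooth f) (hg : IsSmooth g) (k : ℤ) (z : ℍ) :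
    xi k (fun w => f w + g w) z = xi k f z + xi k g z := by
  have h := dbarC_add (hf.differentiableAt z.im_pos) (hg.differentiableAt z.im_pos)
  have hfg : IsSmooth fun w => f w + g w := ContDiffOn.add hf hg
  rw [xi, xi, xi, hfg.dbar_eq, hf.dbar_eq, hg.dbar_eq, h, map_add]
  ring

lemma xi_sum {ι : Type*} (s : Finset ι) {f : ι → ℍ → ℂ} (hf : ∀ i, IsSmooth (f i)) (r : ι → ℂ)
    (k : ℤ) (z : ℍ) :
    xi k (fun w => ∑ i ∈ s, r i * f i w) z = ∑ i ∈ s, conj (r i) * xi k (f i) z := by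
  classical
  induction s using Finset.induction_on with
  | empty => simp [xi, dbar, partialX, partialY, lineDeriv]
  | insert i s hi ih =>
    simp only [Finset.sum_insert hi]
    rw [xi_add ((hf i).const_mul _) (IsSmooth.sum fun j _ => (hf j).const_mul _),
      xi_const_mul (hf i), ih]

lemma partialX_eq_of_hasLineDerivAt {f : ℍ → ℂ} {g : ℂ → ℂ} {z : ℍ} {d : ℂ}
    (hfg : ∀ w : ℂ, 0 < w.im → f (ofComplex w) = g w) (hg : HasLineDerivAt ℝ g d z 1) :
    partialX f z = d := by
  have h : (fun w : ℂ => f (ofComplex w)) =ᶠ[𝓝 (z : ℂ)] g :=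
    (eventually_im_pos z).mono fun w hw => hfg w hw
  rw [partialX, h.lineDeriv_eq, hg.lineDeriv]

lemma partialY_eq_of_hasLineDerivAt {f : ℍ → ℂ} {g : ℂ → ℂ} {z : ℍ} {d : ℂ}
    (hfg : ∀ w : ℂ, 0 < w.im → f (ofComplex w) = g w) (hg : HasLineDerivAt ℝ g d z Complex.I) :
    partialY f z = d := by
  have h : (fun w : ℂ => f (ofComplex w)) =ᶠ[𝓝 (z : ℂ)] g :=
    (eventually_im_pos z).mono fun w hw => hfg w hw
  rw [partialY, h.lineDeriv_eq, hg.lineDeriv]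

/-- The line derivative of `2 i y ^ k` times the conjugate of a function. -/
lemma hasLineDerivAt_im_zpow_mul_conj (k : ℤ) {u : ℂ → ℂ} {z v u' : ℂ} (hz : 0 < z.im)
    (hu : HasLineDerivAt ℝ u u' z v) :
    HasLineDerivAt ℝ (fun w => 2 * Complex.I * (w.im : ℂ) ^ k * conj (u w))
      (2 * Complex.I * (k * (z.im : ℂ) ^ (k - 1) * v.im) * conj (u z) +
        2 * Complex.I * (z.im : ℂ) ^ k * conj u') z v := by
  have hy : (z.im : ℂ) ≠ 0 := by exact_mod_cast hz.ne'
  have h1 : HasDerivAt (fun t : ℝ => ((z + t • v).im : ℂ)) (v.im : ℂ) 0 := by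
    have h : HasDerivAt (fun t : ℝ => z.im + t * v.im) v.im 0 := by
      simpa using ((hasDerivAt_id (0 : ℝ)).mul_const v.im).const_add z.im
    simpa using h.ofReal_comp
  have h2 : HasDerivAt (fun t : ℝ => ((z + t • v).im : ℂ) ^ k)
      (k * (z.im : ℂ) ^ (k - 1) * v.im) 0 := by
    have h := (hasDerivAt_zpow k ((z + (0 : ℝ) • v).im : ℂ) (Or.inl (by simpa using hy)))
    have h' := h.comp_of_eq (0 : ℝ) h1 rfl
    simpa [Function.comp_def] using! h'
  have h3 := (h2.const_mul (2 * Complex.I)).mul (HasDerivAt.star hu)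
  simpa [HasLineDerivAt] using! h3

/-- The hyperbolic Laplacian factors through the `ξ`-operators. -/
lemma hypLaplacian_eq_xi_xi {f : ℍ → ℂ} (hf : IsSmooth f) (k : ℤ) (z : ℍ) :
    hypLaplacian k f z = xi (2 - k) (xi k f) z := by
  set g : ℂ → ℂ := fun w => f (ofComplex w) with hg
  set D := fderiv ℝ (fderiv ℝ g) z with hD
  have hgz := hf.contDiffAt z.im_pos
  have hD' : HasFDerivAt (fderiv ℝ g) D z :=
    ((hgz.fderiv_right (m := 1) (by norm_cast)).differentiableAt
      (by simp)).hasFDerivAt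
  -- The mixed second derivatives must cancel for the Laplacian to appear.
  have hsymm : D 1 Complex.I = D Complex.I 1 :=
    (hgz.isSymmSndFDerivAt (by simp; norm_cast)).eq 1 Complex.I
  have hDv : ∀ v : ℂ, HasFDerivAt (fun w => fderiv ℝ g w v)
      ((ContinuousLinearMap.apply ℝ ℂ v).comp D) (z : ℂ) := fun v =>
    (ContinuousLinearMap.apply ℝ ℂ v).hasFDerivAt.comp (z : ℂ) hD'
  have hX : ∀ w : ℂ, 0 < w.im → partialX f (ofComplex w) = fderiv ℝ g w 1 := fun w hw => by
    rw [hf.partialX_eq, coe_ofComplex hw]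
  have hY : ∀ w : ℂ, 0 < w.im → partialY f (ofComplex w) = fderiv ℝ g w Complex.I :=
    fun w hw => by rw [hf.partialY_eq, coe_ofComplex hw]
  have hXX : partialX (partialX f) z = D 1 1 :=
    partialX_eq_of_hasLineDerivAt hX ((hDv 1).hasLineDerivAt 1)
  have hYY : partialY (partialY f) z = D Complex.I Complex.I :=
    partialY_eq_of_hasLineDerivAt hY ((hDv Complex.I).hasLineDerivAt Complex.I)
  set u : ℂ → ℂ := fun w => 1 / 2 * (fderiv ℝ g w 1 + Complex.I * fderiv ℝ g w Complex.I) with hu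
  have hu' : ∀ v : ℂ, HasLineDerivAt ℝ u
      (1 / 2 * (D v 1 + Complex.I * D v Complex.I)) z v := fun v => by
    have h := (((hDv 1).add ((hDv Complex.I).const_mul Complex.I)).const_mul
      (1 / 2 : ℂ)).hasLineDerivAt v
    simpa [hu, mul_add] using h
  have hxi : ∀ w : ℂ, 0 < w.im →
      xi k f (ofComplex w) = 2 * Complex.I * (w.im : ℂ) ^ k * conj (u w) := fun w hw => by
    rw [xi, dbar, hX w hw, hY w hw, ← UpperHalfPlane.coe_im, coe_ofComplex hw]
  have h1 := partialX_eq_of_hasLineDerivAt hxi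
    (hasLineDerivAt_im_zpow_mul_conj k z.im_pos (hu' 1))
  have h2 := partialY_eq_of_hasLineDerivAt hxi
    (hasLineDerivAt_im_zpow_mul_conj k z.im_pos (hu' Complex.I))
  have hX0 : partialX f z = fderiv ℝ g z 1 := hf.partialX_eq z
  have hY0 : partialY f z = fderiv ℝ g z Complex.I := hf.partialY_eq z
  rw [hypLaplacian, hXX, hYY, hX0, hY0, xi, dbar, h1, h2]
  simp only [Complex.one_im, Complex.I_im, Complex.ofReal_zero, Complex.ofReal_one, mul_zero,
    zero_mul, zero_add, mul_one, map_mul, map_add, map_div₀, map_one, map_ofNat, Complex.conj_I,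
    map_neg, neg_neg, Complex.conj_conj, map_zpow₀, Complex.conj_ofReal, map_intCast, hu, hsymm]
  have hy : ((z : ℂ).im : ℂ) ≠ 0 := by exact_mod_cast z.im_pos.ne'
  rw [← UpperHalfPlane.coe_im]
  set y : ℂ := ((z : ℂ).im : ℂ)
  have e1 : y ^ (2 - k) * y ^ k = y ^ 2 := by
    rw [← zpow_add₀ hy, sub_add_cancel]; rfl
  have e2 : y ^ (2 - k) * y ^ (k - 1) = y := by
    rw [← zpow_add₀ hy, sub_add_sub_cancel]; norm_num
  have hI : Complex.I ^ 2 = -1 := Complex.I_sq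
  linear_combination -(D 1 1 + D Complex.I Complex.I) * e1 +
    Complex.I * k * (fderiv ℝ g z 1 + Complex.I * fderiv ℝ g z Complex.I) * e2 +
    (y ^ (2 - k) * y ^ k * (D 1 1 + D Complex.I Complex.I * (1 - Complex.I ^ 2)) -
      Complex.I * k * y ^ (2 - k) * y ^ (k - 1) *
        (fderiv ℝ g z 1 + Complex.I * fderiv ℝ g z Complex.I)) * hI

end Operators

/-! ### Ramp relations for the modified Taylor coefficients -/

section Tower

variable {a : ℕ}

lemma G_ofComplex (ha : Even a) (n : ℕ) {w : ℂ} (hw : 0 < w.im) :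
    G n ((a + 2 : ℕ) : ℤ) (ofComplex w) = taylorAt (eisPos (a + 2) w) n := by
  rw [G, taylorCoeff, doublyCompletedEis_pos (ha.add even_two) (Nat.succ_pos _),
    coe_ofComplex hw, taylorAt]

lemma F_ofComplex (ha : Even a) (n : ℕ) {w : ℂ} (hw : 0 < w.im) :
    F n (-(a : ℤ)) (ofComplex w) = taylorAt (eisNonpos a w) n := by
  rw [F, taylorCoeff, doublyCompletedEis_neg ha, coe_ofComplex hw, taylorAt]

lemma isSmooth_G (ha : Even a) (n : ℕ) : IsSmooth (G n ((a + 2 : ℕ) : ℤ)) := by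
  obtain ⟨Φ, hΦ, hΦH⟩ := exists_family_eisPos (a + 2)
  exact (taylorAt_smooth (fun z hz => differentiable_eisPos (ha.add even_two) hz) hΦ hΦH n).1.congr
    fun w hw => G_ofComplex ha n hw

lemma isSmooth_F (ha : Even a) (n : ℕ) : IsSmooth (F n (-(a : ℤ))) := by
  obtain ⟨Φ, hΦ, hΦH⟩ := exists_family_eisNonpos a
  exact (taylorAt_smooth (fun z hz => differentiable_eisNonpos ha hz) hΦ hΦH n).1.congr
    fun w hw => F_ofComplex ha n hw

lemma xi_F (ha : Even a) (n : ℕ) (z : ℍ) :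
    xi (-(a : ℤ)) (F n (-(a : ℤ))) z = (-1) ^ n * G n ((a + 2 : ℕ) : ℤ) z := by
  have hy : ((z : ℂ).im : ℂ) ≠ 0 := by exact_mod_cast z.im_pos.ne'
  have hG := G_ofComplex ha n z.im_pos
  rw [ofComplex_apply] at hG
  rw [xi, (isSmooth_F ha n).dbar_eq, dbarC_congr ((eventually_im_pos z).mono fun w hw =>
    F_ofComplex ha n hw), dbarC_taylorAt_eisNonpos ha n z.im_pos, hG, ← UpperHalfPlane.coe_im,
    zpow_neg, zpow_natCast]
  simp only [map_mul, map_div₀, map_pow, map_neg, map_one, map_ofNat, Complex.conj_I,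
    Complex.conj_conj, Complex.conj_ofReal]
  field_simp
  rw [Complex.I_sq]
  ring

lemma xi_G (ha : Even a) (n : ℕ) (z : ℍ) :
    xi ((a + 2 : ℕ) : ℤ) (G n ((a + 2 : ℕ) : ℤ)) z =
      (a + 1) * shiftSeq (fun m => (-1) ^ m * F m (-(a : ℤ)) z) n +
        shiftSeq (shiftSeq fun m => (-1) ^ m * F m (-(a : ℤ)) z) n := by
  have hy : ((z : ℂ).im : ℂ) ≠ 0 := by exact_mod_cast z.im_pos.ne'
  have hF : ∀ m, F m (-(a : ℤ)) z = taylorAt (eisNonpos a z) m := fun m => by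
    rw [← F_ofComplex ha m z.im_pos, ofComplex_apply]
  have hconj : ∀ (b : ℕ → ℂ) n, conj (shiftSeq b n) = shiftSeq (fun m => conj (b m)) n := by
    rintro b (_ | n) <;> simp [shiftSeq]
  rw [xi, (isSmooth_G ha n).dbar_eq, dbarC_congr ((eventually_im_pos z).mono fun w hw =>
    G_ofComplex ha n hw), dbarC_taylorAt_eisPos ha n z.im_pos, ← UpperHalfPlane.coe_im,
    zpow_natCast]
  simp only [map_mul, map_add, map_div₀, map_inv₀, map_pow, map_neg, map_one, map_ofNat,
    Complex.conj_I, hconj, Complex.conj_conj, Complex.conj_ofReal, map_natCast, hF]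
  field_simp
  rw [Complex.I_sq]
  ring

lemma sum_Icc_one_eq (n : ℕ) (u : ℕ → ℂ) :
    u 0 + ∑ l ∈ Finset.Icc 1 n, u l = ∑ l ∈ Finset.range (n + 1), u l := by
  rw [Finset.range_eq_Ico, Finset.sum_eq_sum_Ico_succ_bot n.succ_pos]
  rfl

lemma modG_eq_sum {k : ℤ} {c : ℕ → ℤ → ℂ} {n : ℕ} (hc : c n 0 = 1) :
    modG k c n = fun z => ∑ l ∈ Finset.range (n + 1), ((-1) ^ l * c n l) * G (n - l) k z := by
  ext z
  rw [← sum_Icc_one_eq, modG]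
  simp [hc]

lemma modF_eq_sum {k : ℤ} {c : ℕ → ℤ → ℂ} {n : ℕ} (hc : c n 0 = 1) :
    modF k c n =
      fun z => ∑ l ∈ Finset.range (n + 1), ((-1) ^ n * conj (c n l)) * F (n - l) (2 - k) z := by
  ext z
  rw [← sum_Icc_one_eq, modF, mul_add, Finset.mul_sum]
  simp [hc, mul_assoc]

lemma two_sub_weight (a : ℕ) : 2 - ((a + 2 : ℕ) : ℤ) = -(a : ℤ) := by
  push_cast
  ring

lemma isSmooth_modG (ha : Even a) {c : ℕ → ℤ → ℂ} {n : ℕ} (hc : c n 0 = 1) :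
    IsSmooth (modG ((a + 2 : ℕ) : ℤ) c n) := by
  rw [modG_eq_sum hc]
  exact IsSmooth.sum fun l _ => (isSmooth_G ha _).const_mul _

lemma isSmooth_modF (ha : Even a) {c : ℕ → ℤ → ℂ} {n : ℕ} (hc : c n 0 = 1) :
    IsSmooth (modF ((a + 2 : ℕ) : ℤ) c n) := by
  rw [modF_eq_sum hc, two_sub_weight]
  exact IsSmooth.sum fun l _ => (isSmooth_F ha _).const_mul _

lemma neg_one_pow_mul_sub {n l : ℕ} (h : l ≤ n) : (-1 : ℂ) ^ n * (-1) ^ (n - l) = (-1) ^ l := by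
  obtain ⟨m, rfl⟩ := Nat.exists_eq_add_of_le h
  rw [Nat.add_sub_cancel_left, pow_add, mul_assoc, ← mul_pow]
  simp

/-- The coefficients of `modF` are the conjugates of those of `modG` up to sign, and `ξ` is
conjugate-linear; only `c_{n,0} = 1` is used, not the recursion. -/
lemma xi_modF (ha : Even a) {c : ℕ → ℤ → ℂ} {n : ℕ} (hc : c n 0 = 1) (z : ℍ) :
    xi (2 - ((a + 2 : ℕ) : ℤ)) (modF ((a + 2 : ℕ) : ℤ) c n) z = modG ((a + 2 : ℕ) : ℤ) c n z := by
  rw [modF_eq_sum hc, modG_eq_sum hc, two_sub_weight]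
  rw [xi_sum _ (fun l => isSmooth_F ha (n - l))]
  refine Finset.sum_congr rfl fun l hl => ?_
  rw [xi_F ha, ← neg_one_pow_mul_sub (Nat.lt_succ_iff.1 (Finset.mem_range.1 hl))]
  simp only [map_mul, map_pow, map_neg, map_one, Complex.conj_conj]
  ring

lemma sum_mul_shiftSeq (u b : ℕ → ℂ) (m : ℕ) :
    ∑ l ∈ Finset.range (m + 2), u l * shiftSeq b (m + 1 - l) =
      ∑ l ∈ Finset.range (m + 1), u l * b (m - l) := by
  rw [Finset.sum_range_succ, Nat.sub_self, shiftSeq, mul_zero, add_zero]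
  refine Finset.sum_congr rfl fun l hl => ?_
  rw [Nat.sub_add_comm (Nat.lt_succ_iff.1 (Finset.mem_range.1 hl)), shiftSeq]

lemma sum_mul_shiftSeq_eq_sum_shiftSeq_mul (u b : ℕ → ℂ) (m : ℕ) :
    ∑ l ∈ Finset.range (m + 1), u l * shiftSeq b (m - l) =
      ∑ l ∈ Finset.range (m + 1), shiftSeq u l * b (m - l) := by
  cases m with
  | zero => simp [shiftSeq]
  | succ m =>
    rw [sum_mul_shiftSeq, Finset.sum_range_succ' _ (m + 1)]
    simp [shiftSeq]

/-- After reindexing the doubly shifted sum, the coefficient of each `F_{m-ℓ}` involves only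
`c_{m+1,ℓ}` and `c_{m+1,ℓ-1}`, and the connection equation combines them. -/
lemma xi_modG (ha : Even a) {c : ℕ → ℤ → ℂ} (hc : ConnectionEquations ((a + 2 : ℕ) : ℤ) c) (m : ℕ)
    (z : ℍ) : xi ((a + 2 : ℕ) : ℤ) (modG ((a + 2 : ℕ) : ℤ) c (m + 1)) z =
      (a + 1) * modF ((a + 2 : ℕ) : ℤ) c m z := by
  have ha1 : (a : ℂ) + 1 ≠ 0 := Nat.cast_add_one_ne_zero a
  rw [modG_eq_sum (hc.zero _), modF_eq_sum (hc.zero _), two_sub_weight,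
    xi_sum _ (fun l => isSmooth_G ha (m + 1 - l))]
  set b : ℕ → ℂ := fun m => (-1) ^ m * F m (-(a : ℤ)) z with hb
  set u : ℕ → ℂ := fun l => conj ((-1) ^ l * c (m + 1) l) with hu
  have h1 : ∀ l : ℕ, u l * xi ((a + 2 : ℕ) : ℤ) (G (m + 1 - l) ((a + 2 : ℕ) : ℤ)) z =
      (a + 1) * (u l * shiftSeq b (m + 1 - l)) + u l * shiftSeq (shiftSeq b) (m + 1 - l) :=
    fun l => by rw [xi_G ha]; ring
  refine (Finset.sum_congr rfl fun l _ => h1 l).trans ?_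
  rw [Finset.sum_add_distrib, ← Finset.mul_sum, sum_mul_shiftSeq, sum_mul_shiftSeq,
    sum_mul_shiftSeq_eq_sum_shiftSeq_mul, Finset.mul_sum, Finset.mul_sum,
    ← Finset.sum_add_distrib]
  refine Finset.sum_congr rfl fun l hl => ?_
  have hlm : l ≤ m := Nat.lt_succ_iff.1 (Finset.mem_range.1 hl)
  have hrec := hc.rec_eq (m + 1) (Nat.succ_pos m) l (Int.natCast_nonneg l)
    (by exact_mod_cast hlm.trans m.le_succ)
  have hcast : ((((a + 2 : ℕ) : ℤ) : ℂ) - 1) = a + 1 := by push_cast; ring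
  rw [hcast, Nat.add_sub_cancel] at hrec
  have hrec2 : (a + 1) * conj (c (m + 1) l) - conj (c (m + 1) (l - 1)) =
      (a + 1) * conj (c m l) := by
    have h : (a + 1) * c (m + 1) l - c (m + 1) (l - 1) = (a + 1) * c m l := by
      rw [hrec]
      field_simp
      ring
    simpa using congrArg (starRingEnd ℂ) h
  -- For `ℓ = 0` this is the convention `c_{n,-1} = 0`.
  have hshift : shiftSeq u l = -((-1) ^ l * conj (c (m + 1) (l - 1))) := by
    cases l with
    | zero => simp [shiftSeq, hc.neg_one]
    | succ l => simp [shiftSeq, hu, pow_succ]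
  have hsign : (-1 : ℂ) ^ m = (-1) ^ l * (-1) ^ (m - l) := by
    rw [← pow_add, Nat.add_sub_cancel' hlm]
  rw [hshift, hb, hsign]
  simp only [hu, map_mul, map_pow, map_neg, map_one]
  linear_combination (-1) ^ l * ((-1) ^ (m - l) * F (m - l) (-(a : ℤ)) z) * hrec2

end Tower

/-- Constants solving the connection equations with prescribed values at `ℓ = n + 1`. -/
def connectionConstants (r : ℂ) (d : ℕ → ℂ) : ℕ → ℕ → ℂ
  | _, 0 => 1
  | 0, _ + 1 => d 0
  | n + 1, l + 1 =>
    -- Here the second index is `l + 1`, so `l = n + 1` is the free place of row `n + 1`.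
    if l = n + 1 then d (n + 1)
    else r * connectionConstants r d (n + 1) l + connectionConstants r d n (l + 1)

/-- In row `n` the equations determine the entries with `1 ≤ ℓ ≤ n` from the entry before and the
row above, whose last entry is `c_{n-1,n}`. They never prescribe `c_{n,n+1}`. -/
lemma exists_connectionEquations (k : ℤ) (d : ℕ → ℂ) :
    ∃ c : ℕ → ℤ → ℂ, ConnectionEquations k c ∧ ∀ n : ℕ, c n ((n : ℤ) + 1) = d n := by
  refine ⟨fun n l => if l < 0 then 0 else connectionConstants (1 / ((k : ℂ) - 1)) d n l.toNat,
    ⟨fun n => ?_, fun n => ?_, fun n hn l hl hln => ?_⟩, fun n => ?_⟩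
  · simp [connectionConstants]
  · simp
  · obtain ⟨n, rfl⟩ := Nat.exists_eq_add_of_le' hn
    obtain ⟨l, rfl⟩ := Int.eq_ofNat_of_zero_le hl
    cases l with
    | zero => simp [connectionConstants]
    | succ l =>
      have hne : l ≠ n + 1 := by omega
      have h0 : ¬ ((l : ℤ) + 1 < 0) := by omega
      have h1 : ((l : ℤ) + 1).toNat = l + 1 := by omega
      simp [connectionConstants, hne, h0, h1]
  · have h0 : ¬ ((n : ℤ) + 1 < 0) := by omega
    have h1 : ((n : ℤ) + 1).toNat = n + 1 := by omega
    cases n with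
    | zero => simp [connectionConstants]
    | succ n =>
      simp only [h0, h1, if_false]
      simp [connectionConstants]

end PolyMaass

end

theorem mainTheorem9 (k : ℤ) (hk_even : Even k) (hk : 2 ≤ k) :
    -- the doubly completed Eisenstein series of weights `k` and `2 - k` are well defined
    -- as entire functions of `s`
    (∀ z : UpperHalfPlane,
      PolyMaass.IsEntireContinuation k z (PolyMaass.doublyCompletedEis k z) ∧
      PolyMaass.IsEntireContinuation (2 - k) z (PolyMaass.doublyCompletedEis (2 - k) z)) ∧
    (∀ c : ℕ → ℤ → ℂ, PolyMaass.ConnectionEquations k c →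
      (∀ n : ℕ, PolyMaass.IsSmooth (PolyMaass.modG k c n) ∧
        PolyMaass.IsSmooth (PolyMaass.modF k c n)) ∧
      -- ramp relations
      (∀ n : ℕ, 1 ≤ n → ∀ z : UpperHalfPlane,
        PolyMaass.xi k (PolyMaass.modG k c n) z
          = ((k : ℂ) - 1) * PolyMaass.modF k c (n - 1) z) ∧
      (∀ n : ℕ, 1 ≤ n → ∀ z : UpperHalfPlane,
        PolyMaass.xi (2 - k) (PolyMaass.modF k c n) z = PolyMaass.modG k c n z) ∧
      -- tower relations
      (∀ n : ℕ, 1 ≤ n → ∀ z : UpperHalfPlane,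
        PolyMaass.hypLaplacian k (PolyMaass.modG k c n) z
          = ((k : ℂ) - 1) * PolyMaass.modG k c (n - 1) z) ∧
      (∀ n : ℕ, 1 ≤ n → ∀ z : UpperHalfPlane,
        PolyMaass.hypLaplacian (2 - k) (PolyMaass.modF k c n) z
          = ((k : ℂ) - 1) * PolyMaass.modF k c (n - 1) z)) ∧
    -- the constants `c_{n,k,n+1}` are free
    (∀ d : ℕ → ℂ, ∃ c : ℕ → ℤ → ℂ, PolyMaass.ConnectionEquations k c ∧
      ∀ n : ℕ, c n ((n : ℤ) + 1) = d n) := by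
  obtain ⟨a, rfl⟩ : ∃ a : ℕ, k = ((a + 2 : ℕ) : ℤ) := ⟨(k - 2).toNat, by omega⟩
  have ha : Even a := by
    rcases Nat.even_or_odd a with h | h
    · exact h
    · have : Even (a + 2) := by exact_mod_cast hk_even
      grind
  have hcast : ((((a + 2 : ℕ) : ℤ) : ℂ) - 1) = a + 1 := by push_cast; ring
  refine ⟨fun z => ⟨?_, ?_⟩, fun c hc => ⟨fun n => ⟨PolyMaass.isSmooth_modG ha (hc.zero n),
    PolyMaass.isSmooth_modF ha (hc.zero n)⟩, ?_, fun n _ z => PolyMaass.xi_modF ha (hc.zero n) z,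
    ?_, ?_⟩, fun d => PolyMaass.exists_connectionEquations _ d⟩
  · exact PolyMaass.isEntireContinuation_eis
      (PolyMaass.isEntireContinuation_eisPos (ha.add even_two) (Nat.succ_pos _) z)
  · rw [PolyMaass.two_sub_weight]
    exact PolyMaass.isEntireContinuation_eis (PolyMaass.isEntireContinuation_eisNonpos ha z)
  · intro n hn z
    obtain ⟨m, rfl⟩ := Nat.exists_eq_add_of_le' hn
    rw [PolyMaass.xi_modG ha hc, hcast, Nat.add_sub_cancel]
  · intro n hn z
    obtain ⟨m, rfl⟩ := Nat.exists_eq_add_of_le' hn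
    rw [PolyMaass.hypLaplacian_eq_xi_xi (PolyMaass.isSmooth_modG ha (hc.zero _)),
      funext (PolyMaass.xi_modG ha hc m), hcast, Nat.add_sub_cancel,
      PolyMaass.xi_const_mul (PolyMaass.isSmooth_modF ha (hc.zero m)),
      PolyMaass.xi_modF ha (hc.zero m)]
    -- `ξ` conjugates the constant, but `k - 1` is real.
    simp
  · intro n hn z
    obtain ⟨m, rfl⟩ := Nat.exists_eq_add_of_le' hn
    rw [PolyMaass.hypLaplacian_eq_xi_xi (PolyMaass.isSmooth_modF ha (hc.zero _)),
      funext (PolyMaass.xi_modF ha (hc.zero (m + 1))), sub_sub_cancel, PolyMaass.xi_modG ha hc,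
      hcast, Nat.add_sub_cancel]
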